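/- **Setting.** Let $U:\mathbb{R}^d\to\mathbb{R}$ be continuously differentiable with $\int e^{-U(x)}\,dx<\infty$, and let $\pi$ be the probability measure with Lebesgue density proportional to $e^{-U}$. Put $H(x,p)=U(x)+\tfrac12\|p\|^2$, fix a step size $\varepsilon>0$, a probability distribution $\mathfrak{L}$ on the non-negative integers and $\delta\in(1/2,1)$. For $(x_0,p_0)\in\mathbb{R}^{2d}$ let $(x_{i\varepsilon},p_{i\varepsilon})$ be the result of $i$ leapfrog steps $$p_{t+\varepsilon/2}=p_t-\tfrac{\varepsilon}{2}\nabla U(x_t),\quad x_{t+\varepsilon}=x_t+\varepsilon p_{t+\varepsilon/2},\quad p_{t+\varepsilon}=p_{t+\varepsilon/2}-\tfrac{\varepsilon}{2}\nabla U(x_{t+\varepsilon}),$$ and let $\alpha_L(x_0,p_0)=1\wedge\exp\big(H(x_0,p_0)-H(x_{L\varepsilon},p_{L\varepsilon})\big)$. One iteration of Hamiltonian Monte Carlo (HMC) from $x_0$ draws $L\sim\mathfrak{L}$, $p_0\sim N(0,I)$ and $u\sim U[0,1]$ independently and moves to $x_{L\varepsilon}$ if $u<\alpha_L(x_0,p_0)$,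 and otherwise stays at $x_0$. Let $P$ be its transition kernel. Let $$\psi_{L,\varepsilon}(x_0,p_0)=\tfrac{L\varepsilon^2}{2}\nabla U(x_0)+\varepsilon^2\sum_{i=1}^{L-1}(L-i)\nabla U(x_{i\varepsilon}),\qquad m_{L,\varepsilon}(x_0,p_0)=x_0-\psi_{L,\varepsilon}(x_0,p_0).$$ The chain is *geometrically ergodic* if there are $\rho<1$ and a $\pi$-a.e. finite $M:\mathbb{R}^d\to[0,\infty]$ with $\|P^n(x,\cdot)-\pi\|_{TV}\le M(x)\rho^n$ for all $n\ge 0$ and all $x$, where $\|\mu-\nu\|_{TV}=\sup_{|f|\le1}|\int f\,d\mu-\int f\,d\nu|$. **Assumptions.** * (A1) $\mathfrak{L}(\{1\})>0$, and for every $(x_0,p_0)$ there is an $s>0$ with $\mathbb{E}_{L\sim\mathfrak{L}}\big[e^{s\|x_{L\varepsilon}\|}\big]<\infty$. * (Inwards acceptance, A3) For every $L$ with $\mathfrak{L}(\{L\})>0$, $$\lim_{\|x_0\|\to\infty}\mathbb{P}_{p_0\sim N(0,I)}\big[\alpha_L(x_0,p_0)<1,\ \|x_{L\varepsilon}\|\le\|x_0\|\big]=0.$$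 * (Mean drift) For every $L$ with $\mathfrak{L}(\{L\})>0$, $$\limsup_{\|x_0\|\to\infty,\ \|p_0\|\le\|x_0\|^\delta}\big(\|m_{L,\varepsilon}(x_0,p_0)\|-\|x_0\|\big)<0.$$ * (A2) $\liminf_{\|x\|\to\infty}\|\nabla U(x)\|>0$ and $\liminf_{\|x\|\to\infty}\frac{\langle\nabla U(x),x\rangle}{\|\nabla U(x)\|\|x\|}>0$, and in addition either $\lim_{\|x\|\to\infty}\frac{\|\nabla U(x)\|}{\|x\|}=0$, or else $\limsup_{\|x\|\to\infty}\frac{\|\nabla U(x)\|}{\|x\|}=S$ for some $S<\infty$ and $\varepsilon$ is small enough that, for every $L$ with $\mathfrak{L}(\{L\})>0$ and writing $\psi=\psi_{L,\varepsilon}(x_0,p_0)$, $$\liminf_{\|x_0\|\to\infty,\ \|p_0\|\le\|x_0\|^\delta}\frac{\|\psi\|^2-2\langle\psi,x_0\rangle}{\|x_0\|^2}>-1,\qquad \limsup_{\|x_0\|\to\infty,\ \|p_0\|\le\|x_0\|^\delta}\frac{\|\psi\|^2-2\langle\psi,x_0\rangle}{2\|x_0\|}<0.$$ **Theorem.** Assume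 (A1) and inwards acceptance (A3). 1. If the mean drift condition holds, then the HMC chain is geometrically ergodic. 2. If (A2) holds, then the HMC chain is geometrically ergodic. -/

import Mathlib

open MeasureTheory ProbabilityTheory Filter Topology
open scoped ENNReal NNReal

noncomputable section

namespace HMC

/-- The state space `ℝ^d` with its Euclidean norm. -/
abbrev E (d : ℕ) : Type := EuclideanSpace ℝ (Fin d)

variable {d : ℕ}

/-- The target distribution: the probability measure with Lebesgue density proportional to
`exp (-U x)`. -/
def target (U : E d → ℝ) : Measure (E d) :=
  (volume : Measure (E d)).tilted (fun x => -U x)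

/-- The Hamiltonian `H(x, p) = U(x) + ‖p‖² / 2` (identity mass matrix). -/
def hamiltonian (U : E d → ℝ) (z : E d × E d) : ℝ :=
  U z.1 + ‖z.2‖ ^ 2 / 2

/-- One leapfrog step of size `ε` on phase space: half step in momentum, full step in position,
half step in momentum. -/
def leapfrogStep (U : E d → ℝ) (ε : ℝ) (z : E d × E d) : E d × E d :=
  let pHalf : E d := z.2 - (ε / 2) • gradient U z.1
  let x' : E d := z.1 + ε • pHalf
  let p' : E d := pHalf - (ε / 2) • gradient U x'
  (x', p')

/-- The approximate flow map `(x₀, p₀) ↦ (x_{Lε}, p_{Lε})`: `L` leapfrog steps. -/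
def leapfrog (U : E d → ℝ) (ε : ℝ) (L : ℕ) : E d × E d → E d × E d :=
  (leapfrogStep U ε)^[L]

/-- The position `x_{iε}` after `i` leapfrog steps from `(x₀, p₀)`. -/
def pos (U : E d → ℝ) (ε : ℝ) (i : ℕ) (x₀ p₀ : E d) : E d :=
  (leapfrog U ε i (x₀, p₀)).1

/-- The acceptance probability `min(1, exp(H(x₀, p₀) - H(x_{Lε}, p_{Lε})))`. -/
def acceptProb (U : E d → ℝ) (ε : ℝ) (L : ℕ) (x₀ p₀ : E d) : ℝ :=
  min 1 (Real.exp (hamiltonian U (x₀, p₀) - hamiltonian U (leapfrog U ε L (x₀, p₀))))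

open Classical in
/-- One iteration of Hamiltonian Monte Carlo from `x`, as a function of the number `θ.1` of leapfrog
steps, the momentum `θ.2.1` and the uniform variable `θ.2.2` of the accept/reject step. -/
def hmcStep (U : E d → ℝ) (ε : ℝ) (x : E d) (θ : ℕ × E d × ℝ) : E d :=
  if θ.2.2 < acceptProb U ε θ.1 x θ.2.1 then pos U ε θ.1 x θ.2.1 else x

/-- The law of the randomness of one iteration: independently `L ∼ 𝔏`, `p₀ ∼ N(0, I)` and
`u ∼ Uniform[0, 1]`. -/
def noiseLaw (d : ℕ) (𝔏 : PMF ℕ) : Measure (ℕ × E d × ℝ) :=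
  𝔏.toMeasure.prod ((stdGaussian (E d)).prod ((volume : Measure ℝ).restrict (Set.Icc 0 1)))

instance (𝔏 : PMF ℕ) : IsProbabilityMeasure (noiseLaw d 𝔏) := by
  have : IsProbabilityMeasure ((volume : Measure ℝ).restrict (Set.Icc (0 : ℝ) 1)) :=
    ⟨by simp⟩
  unfold noiseLaw
  infer_instance

theorem continuous_gradient {U : E d → ℝ} (hU : ContDiff ℝ 1 U) : Continuous (gradient U) :=
  (InnerProductSpace.toDual ℝ (E d)).symm.continuous.comp (hU.continuous_fderiv (by simp))

theorem continuous_leapfrog {U : E d → ℝ} (hU : ContDiff ℝ 1 U) (ε : ℝ) (L : ℕ) :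
    Continuous (leapfrog U ε L) := by
  have hg := continuous_gradient hU
  apply Continuous.iterate
  unfold leapfrogStep
  fun_prop

theorem measurable_hmcStep {U : E d → ℝ} (hU : ContDiff ℝ 1 U) (ε : ℝ) :
    Measurable (fun z : E d × (ℕ × E d × ℝ) => hmcStep U ε z.1 z.2) := by
  have key : ∀ L : ℕ, Measurable (fun z : E d × E d × ℝ => hmcStep U ε z.1 (L, z.2)) := by
    intro L
    have hl := continuous_leapfrog hU ε L
    have hc := hU.continuous
    have ha : Continuous (fun z : E d × E d × ℝ => acceptProb U ε L z.1 z.2.1) := by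
      unfold acceptProb hamiltonian
      fun_prop
    have hp : Continuous (fun z : E d × E d × ℝ => pos U ε L z.1 z.2.1) := by
      unfold pos
      fun_prop
    unfold hmcStep
    exact Measurable.ite (measurableSet_lt (by fun_prop) ha.measurable) hp.measurable
      measurable_fst
  have h2 : Measurable (fun w : ℕ × (E d × E d × ℝ) => hmcStep U ε w.2.1 (w.1, w.2.2)) :=
    measurable_from_prod_countable_right key
  exact h2.comp (g := fun w : ℕ × (E d × E d × ℝ) => hmcStep U ε w.2.1 (w.1, w.2.2))
    (f := fun z : E d × (ℕ × E d × ℝ) => (z.2.1, z.1, z.2.2)) (by fun_prop)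

/-- The transition kernel of the Hamiltonian Monte Carlo chain: `P(x, ·)` is the law of the next
state when the current state is `x`. -/
def hmcKernel {U : E d → ℝ} (hU : ContDiff ℝ 1 U) (ε : ℝ) (𝔏 : PMF ℕ) : Kernel (E d) (E d) where
  toFun x := (noiseLaw d 𝔏).map (hmcStep U ε x)
  measurable' := by
    refine Measure.measurable_of_measurable_coe _ fun s hs => ?_
    have hm := measurable_hmcStep hU ε
    have : ∀ x, (noiseLaw d 𝔏).map (hmcStep U ε x) s
        = noiseLaw d 𝔏 (Prod.mk x ⁻¹' ((fun z : E d × (ℕ × E d × ℝ) => hmcStep U ε z.1 z.2) ⁻¹' s)) :=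
      fun x => Measure.map_apply (hm.comp measurable_prodMk_left) hs
    simp_rw [this]
    exact measurable_measure_prodMk_left (hm hs)

instance {U : E d → ℝ} (hU : ContDiff ℝ 1 U) (ε : ℝ) (𝔏 : PMF ℕ) :
    IsMarkovKernel (hmcKernel hU ε 𝔏) :=
  ⟨fun _ => Measure.isProbabilityMeasure_map
    ((measurable_hmcStep hU ε).comp measurable_prodMk_left).aemeasurable⟩

/-- Total variation distance `sup_{|f| ≤ 1} |∫ f dμ - ∫ f dν|` over measurable `f`. -/
def tvDist (μ ν : Measure (E d)) : ℝ≥0∞ :=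
  ⨆ (f : E d → ℝ) (_ : Measurable f) (_ : ∀ x, |f x| ≤ 1),
    ENNReal.ofReal |(∫ x, f x ∂μ) - ∫ x, f x ∂ν|

/-- Geometric ergodicity: `‖Pⁿ(x, ·) - π‖_TV ≤ M(x) ρⁿ` for all `n` and `x`, where `ρ < 1` and
`M : X → [0, ∞]` is finite `π`-almost everywhere. (`0 < ρ` is no restriction; it avoids the
product `∞ * 0`.) -/
def GeometricallyErgodic (P : Kernel (E d) (E d)) (π : Measure (E d)) : Prop :=
  ∃ ρ : ℝ, 0 < ρ ∧ ρ < 1 ∧ ∃ M : E d → ℝ≥0∞, (∀ᵐ x ∂π, M x < ∞) ∧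
    ∀ (n : ℕ) (x : E d), tvDist ((P ^ n) x) π ≤ M x * ENNReal.ofReal ρ ^ n

/-- The proposal drift `ψ_{L,ε}(x₀, p₀)`. -/
def drift (U : E d → ℝ) (ε : ℝ) (L : ℕ) (x₀ p₀ : E d) : E d :=
  ((L : ℝ) * ε ^ 2 / 2) • gradient U x₀
    + ε ^ 2 • ∑ i ∈ Finset.Ico 1 L, ((L : ℝ) - (i : ℝ)) • gradient U (pos U ε i x₀ p₀)

/-- The mean next candidate position `m_{L,ε}(x₀, p₀) = x₀ - ψ_{L,ε}(x₀, p₀)`. -/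
def meanPos (U : E d → ℝ) (ε : ℝ) (L : ℕ) (x₀ p₀ : E d) : E d :=
  x₀ - drift U ε L x₀ p₀

/-- The regime `‖x₀‖ → ∞`. -/
def farPos (d : ℕ) : Filter (E d) := comap (fun x => ‖x‖) atTop

/-- The regime `‖x₀‖ → ∞`, `‖p₀‖ ≤ ‖x₀‖ ^ δ`, on pairs `(x₀, p₀)`. -/
def farPhase (d : ℕ) (δ : ℝ) : Filter (E d × E d) :=
  comap (fun z => ‖z.1‖) atTop ⊓ 𝓟 {z | ‖z.2‖ ≤ ‖z.1‖ ^ δ}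

/-- One leapfrog step has positive probability, and for every starting point the norm of the
candidate position has some finite exponential moment over the number of leapfrog steps. -/
def StepNumberCondition (U : E d → ℝ) (ε : ℝ) (𝔏 : PMF ℕ) : Prop :=
  0 < 𝔏 1 ∧ ∀ x₀ p₀ : E d, ∃ s : ℝ, 0 < s ∧
    ∑' L : ℕ, 𝔏 L * ENNReal.ofReal (Real.exp (s * ‖pos U ε L x₀ p₀‖)) < ∞

/-- `limsup (‖m_{L,ε}(x₀, p₀)‖ - ‖x₀‖) < 0` as `‖x₀‖ → ∞`, `‖p₀‖ ≤ ‖x₀‖ ^ δ`. -/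
def MeanDriftCondition (U : E d → ℝ) (ε δ : ℝ) (L : ℕ) : Prop :=
  limsup (fun z : E d × E d => ((‖meanPos U ε L z.1 z.2‖ - ‖z.1‖ : ℝ) : EReal)) (farPhase d δ) < 0

/-- Inwards acceptance: the probability, over the Gaussian momentum, that the candidate lies in the
potential rejection region and is no further from the origin than `x₀` tends to zero as
`‖x₀‖ → ∞`. -/
def InwardsAcceptance (U : E d → ℝ) (ε : ℝ) (L : ℕ) : Prop :=
  Tendsto (fun x₀ : E d => stdGaussian (E d)
    {p₀ | acceptProb U ε L x₀ p₀ < 1 ∧ ‖pos U ε L x₀ p₀‖ ≤ ‖x₀‖}) (farPos d) (𝓝 0)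

/-- `liminf ‖∇U(x)‖ > 0` as `‖x‖ → ∞`. -/
def GradNonvanishing (U : E d → ℝ) : Prop :=
  0 < liminf (fun x : E d => ((‖gradient U x‖ : ℝ) : EReal)) (farPos d)

/-- `liminf ⟨∇U(x), x⟩ / (‖∇U(x)‖ ‖x‖) > 0` as `‖x‖ → ∞`. -/
def GradInwards (U : E d → ℝ) : Prop :=
  0 < liminf (fun x : E d =>
    ((inner ℝ (gradient U x) x / (‖gradient U x‖ * ‖x‖) : ℝ) : EReal)) (farPos d)

/-- `‖∇U(x)‖ / ‖x‖ → 0` as `‖x‖ → ∞`. -/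
def GradSublinear (U : E d → ℝ) : Prop :=
  Tendsto (fun x : E d => ‖gradient U x‖ / ‖x‖) (farPos d) (𝓝 0)

/-- `limsup ‖∇U(x)‖ / ‖x‖ = S` as `‖x‖ → ∞`, for some finite `S`. -/
def GradAtMostLinear (U : E d → ℝ) : Prop :=
  ∃ S : ℝ, limsup (fun x : E d => ((‖gradient U x‖ / ‖x‖ : ℝ) : EReal)) (farPos d) = (S : EReal)

/-- The two conditions on the proposal drift that make `ε` suitably small. -/
def SmallStepCondition (U : E d → ℝ) (ε δ : ℝ) (L : ℕ) : Prop :=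
  -1 < liminf (fun z : E d × E d =>
      (((‖drift U ε L z.1 z.2‖ ^ 2 - 2 * inner ℝ (drift U ε L z.1 z.2) z.1) / ‖z.1‖ ^ 2 : ℝ) : EReal))
      (farPhase d δ) ∧
  limsup (fun z : E d × E d =>
      (((‖drift U ε L z.1 z.2‖ ^ 2 - 2 * inner ℝ (drift U ε L z.1 z.2) z.1) / (2 * ‖z.1‖) : ℝ) : EReal))
      (farPhase d δ) < 0

/-- The tail condition on the potential: the gradient is asymptotically non-negligible and points
inwards, and it either grows sublinearly, or grows at most linearly with `ε` suitably small for
every number of leapfrog steps that can occur. -/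
def TailCondition (U : E d → ℝ) (ε δ : ℝ) (𝔏 : PMF ℕ) : Prop :=
  GradNonvanishing U ∧ GradInwards U ∧
    (GradSublinear U ∨ (GradAtMostLinear U ∧ ∀ L ∈ 𝔏.support, SmallStepCondition U ε δ L))

end HMC

end

/-! Everything is carried by the single-leapfrog component of the chain. For each `L` the leapfrog
map followed by momentum reversal is a volume-preserving involution, so the `L`-step kernel is
reversible for the target, and so is their mixture (`hmcKernel_isReversible`). The mixture dominates
`𝔏 1` times the one-step kernel. Since the Dirichlet form is monotone in the joint law of two
consecutive states, a spectral estimate for the one-step kernel passes to the mixture, and no drift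
estimate is needed for other `L`.

For one step the proposal is Gaussian around `meanPos U ε 1 x 0`. Each of the alternative tail
conditions puts this mean closer to the origin than `x` by a fixed amount, for `x` far out. Inwards
acceptance makes the loss from rejections negligible, so `exp (s ‖x‖)` satisfies a geometric drift
condition (`exists_drift`), and compact sets are small (`exists_minorization`).

For a reversible kernel, drift and minorization combine through a Schur test (`ip_op_le_of_drift`)
into `⟨f, η f⟩ ≤ r ⟨f, f⟩ + β ⟨1_C, f⟩²` with `r < 1`. After the comparison `dirichlet_le`, the
mixture with its rank-one minorizing part removed is a positive operator of numerical radius below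
one. Removing rank one costs nothing on centered functions, so the mixture contracts them in L².
`ae_exists_geometric_bound` turns this into pointwise total variation decay by expanding powers of
the kernel in powers of the positive residual operator, whose action on the constant `1` decays
geometrically at almost every point. -/

namespace HMC

/-! ### Symmetric operators and numerical radius -/

section LinearAlgebra

variable {V : Type*} [AddCommGroup V] [Module ℝ V]

/-- A symmetric operator is bounded by its numerical radius. -/
theorem apply_sq_le_of_numericalRadius_le (ip : V →ₗ[ℝ] V →ₗ[ℝ] ℝ)
    (hip : ∀ f g, ip f g = ip g f) (T : V →ₗ[ℝ] V) (hT : ∀ f g, ip (T f) g = ip f (T g))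
    (S : Submodule ℝ V) (hS : ∀ f ∈ S, T f ∈ S) {r : ℝ} (hr : 0 < r)
    (h : ∀ f ∈ S, |ip f (T f)| ≤ r * ip f f) {f : V} (hf : f ∈ S) :
    ip (T f) (T f) ≤ r ^ 2 * ip f f := by
  -- Polarization with the test vectors `f ± r⁻¹ T f`: the difference of the quadratic forms is `(4
  -- / r) ⟨T f, T f⟩`, while the parallelogram law bounds it by `2 r ⟨f, f⟩ + (2 / r) ⟨T f, T f⟩`.
  have h1 := (abs_le.1 (h _ (S.add_mem hf (S.smul_mem r⁻¹ (hS f hf))))).2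
  have h2 := (abs_le.1 (h _ (S.sub_mem hf (S.smul_mem r⁻¹ (hS f hf))))).1
  have e1 : ip f (T (T f)) = ip (T f) (T f) := (hT _ _).symm
  have e2 : ip (T f) f = ip f (T f) := hip _ _
  simp only [map_add, map_sub, map_smul, LinearMap.add_apply, LinearMap.sub_apply,
    LinearMap.smul_apply, smul_eq_mul, e1, e2] at h1 h2
  field_simp at h1 h2
  nlinarith

/-- Rank-one perturbation: if `T` fixes `e` and `T - β ⟨c, ·⟩ c` has numerical radius at most `r`,
then so has the restriction of `T` to the orthogonal complement of `e`. -/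
theorem abs_ip_le_of_rankOne (ip : V →ₗ[ℝ] V →ₗ[ℝ] ℝ)
    (hip : ∀ f g, ip f g = ip g f) (T : V →ₗ[ℝ] V)
    (hT : ∀ f g, ip (T f) g = ip f (T g)) {e c : V} (he : T e = e) (hee : ip e e = 1)
    (hce : ip c e ≠ 0) {β r : ℝ} (hβ : 0 ≤ β) (hr : r ≤ 1)
    (h : ∀ f, |ip f (T f) - β * ip c f ^ 2| ≤ r * ip f f) {f : V} (hf : ip f e = 0) :
    |ip f (T f)| ≤ r * ip f f := by
  have h1 := (abs_le.1 (h f)).1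
  -- With this `t`, `f - t e` is orthogonal to `c`, which kills the rank-one term. Passing from `f`
  -- to `f - t e` adds `t²` to both `⟨f, T f⟩` and `⟨f, f⟩`, and `r ≤ 1` absorbs it. The lower bound
  -- needs only `β ≥ 0`.
  set t := ip c f / ip c e with ht
  have h2 := (abs_le.1 (h (f - t • e))).2
  have e1 : ip e f = 0 := by rw [hip, hf]
  have e2 : ip e (T f) = 0 := by rw [← hT, he, e1]
  have e3 : ip c f - t * ip c e = 0 := by rw [ht]; field_simp; ring
  simp only [map_sub, map_smul, LinearMap.sub_apply,
    LinearMap.smul_apply, smul_eq_mul, e1, e2, e3, he, hf, hee] at h2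
  have h3 := mul_nonneg hβ (sq_nonneg (ip c f))
  rw [abs_le]
  constructor
  · linarith
  · nlinarith [sq_nonneg t]

end LinearAlgebra

/-! ### Reversible kernels as operators on bounded functions; Schur test and Dirichlet forms -/

section Chain

variable {X : Type*} [MeasurableSpace X]

variable (X) in
/-- The space of bounded measurable real functions. -/
def BddMeas : Submodule ℝ (X → ℝ) where
  carrier := {f | Measurable f ∧ ∃ c, ∀ x, |f x| ≤ c}
  add_mem' := by
    rintro f g ⟨hf, a, ha⟩ ⟨hg, b, hb⟩
    exact ⟨hf.add hg, a + b, fun x => (abs_add_le _ _).trans (add_le_add (ha x) (hb x))⟩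
  zero_mem' := ⟨measurable_zero, 0, fun x => by simp⟩
  smul_mem' := by
    rintro t f ⟨hf, a, ha⟩
    exact ⟨hf.const_smul t, |t| * a, fun x => by
      simpa [abs_mul] using mul_le_mul_of_nonneg_left (ha x) (abs_nonneg t)⟩

theorem BddMeas.integrable (f : BddMeas X) (μ : Measure X) [IsFiniteMeasure μ] :
    Integrable f.1 μ := by
  obtain ⟨hf, c, hc⟩ := f.2
  exact Integrable.of_bound hf.aestronglyMeasurable c (ae_of_all _ hc)

theorem BddMeas.integrable_mul (f g : BddMeas X) (μ : Measure X) [IsFiniteMeasure μ] :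
    Integrable (fun x => f.1 x * g.1 x) μ := by
  obtain ⟨hf, c, hc⟩ := f.2
  exact (BddMeas.integrable g μ).bdd_mul hf.aestronglyMeasurable (ae_of_all _ hc)

/-- The constant function `1`. -/
def BddMeas.one : BddMeas X := ⟨fun _ => 1, measurable_const, 1, fun _ => by simp⟩

/-- The indicator function of a measurable set. -/
noncomputable def BddMeas.ind {C : Set X} (hC : MeasurableSet C) : BddMeas X :=
  ⟨C.indicator fun _ => 1, measurable_const.indicator hC, 1, fun x => by
    by_cases h : x ∈ C <;> simp [h]⟩

/-- The absolute value of a bounded measurable function. -/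
def BddMeas.abs (f : BddMeas X) : BddMeas X :=
  ⟨fun x => |f.1 x|, by
    obtain ⟨hf, c, hc⟩ := f.2
    exact ⟨by fun_prop, c, fun x => by simpa using hc x⟩⟩

/-- The `L²(μ)` inner product on bounded measurable functions. -/
noncomputable def BddMeas.ip (μ : Measure X) [IsFiniteMeasure μ] :
    BddMeas X →ₗ[ℝ] BddMeas X →ₗ[ℝ] ℝ :=
  LinearMap.mk₂ ℝ (fun f g => ∫ x, f.1 x * g.1 x ∂μ)
    (fun f f' g => by
      rw [← integral_add (BddMeas.integrable_mul f g μ) (BddMeas.integrable_mul f' g μ)]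
      simp [add_mul])
    (fun t f g => by
      simp only [smul_eq_mul, ← integral_const_mul]
      simp [mul_assoc])
    (fun f g g' => by
      rw [← integral_add (BddMeas.integrable_mul f g μ) (BddMeas.integrable_mul f g' μ)]
      simp [mul_add])
    (fun t f g => by
      simp only [smul_eq_mul, ← integral_const_mul]
      simp [mul_left_comm])

theorem BddMeas.ip_apply (μ : Measure X) [IsFiniteMeasure μ] (f g : BddMeas X) :
    BddMeas.ip μ f g = ∫ x, f.1 x * g.1 x ∂μ := rfl

/-- The action of a Markov kernel on bounded measurable functions. -/
noncomputable def BddMeas.op (κ : Kernel X X) [IsMarkovKernel κ] :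
    BddMeas X →ₗ[ℝ] BddMeas X where
  toFun f := ⟨fun x => ∫ y, f.1 y ∂κ x, by
    obtain ⟨hf, c, hc⟩ := f.2
    refine ⟨(hf.stronglyMeasurable.integral_kernel).measurable, c, fun x => ?_⟩
    simpa using norm_integral_le_of_norm_le_const (μ := κ x) (f := f.1) (ae_of_all _ hc)⟩
  map_add' f g := by
    ext x
    exact integral_add (BddMeas.integrable f _) (BddMeas.integrable g _)
  map_smul' t f := by
    ext x
    exact integral_const_mul t _

theorem BddMeas.op_apply (κ : Kernel X X) [IsMarkovKernel κ] (f : BddMeas X) (x : X) :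
    (BddMeas.op κ f).1 x = ∫ y, f.1 y ∂κ x := rfl

theorem BddMeas.op_one (κ : Kernel X X) [IsMarkovKernel κ] :
    BddMeas.op κ (BddMeas.one : BddMeas X) = BddMeas.one := by
  ext x
  simp [BddMeas.op_apply, BddMeas.one]

theorem BddMeas.op_pow_apply (κ : Kernel X X) [IsMarkovKernel κ] (f : BddMeas X) (n : ℕ) (x : X) :
    ((BddMeas.op κ ^ n) f).1 x = ∫ y, f.1 y ∂(κ ^ n) x := by
  induction n generalizing x with
  | zero =>
    have : (κ ^ 0 : Kernel X X) = Kernel.id := rfl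
    rw [pow_zero, this, Kernel.id_apply, integral_dirac' _ _ f.2.1.stronglyMeasurable]
    rfl
  | succ n ih =>
    have hM : IsMarkovKernel (κ ^ n) := by
      clear ih
      induction n with
      | zero => exact inferInstanceAs (IsMarkovKernel (Kernel.id : Kernel X X))
      | succ n ih =>
        rw [pow_succ]
        exact inferInstanceAs (IsMarkovKernel ((κ ^ n) ∘ₖ κ))
    have e : (κ ^ (n + 1) : Kernel X X) = (κ ^ n) ∘ₖ κ := pow_succ κ n
    rw [e, Kernel.integral_comp (BddMeas.integrable f _), pow_succ', Module.End.mul_apply,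
      BddMeas.op_apply]
    simp_rw [ih]

/-- The joint law of two consecutive states of a stationary reversible chain is symmetric. -/
theorem map_swap_compProd {π : Measure X} [IsFiniteMeasure π] {κ : Kernel X X} [IsMarkovKernel κ]
    (hκ : κ.IsReversible π) : (π ⊗ₘ κ).map Prod.swap = π ⊗ₘ κ := by
  refine Measure.ext_prod fun {s t} hs ht => ?_
  rw [Measure.map_apply measurable_swap (hs.prod ht), Set.preimage_swap_prod,
    Measure.compProd_apply_prod ht hs, Measure.compProd_apply_prod hs ht]
  exact hκ ht hs

theorem BddMeas.integrable_compProd (π : Measure X) [IsFiniteMeasure π] (κ : Kernel X X)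
    [IsMarkovKernel κ] (f g : BddMeas X) :
    Integrable (fun z : X × X => f.1 z.1 * g.1 z.2) (π ⊗ₘ κ) := by
  obtain ⟨hf, a, ha⟩ := f.2
  obtain ⟨hg, b, hb⟩ := g.2
  refine Integrable.of_bound (by fun_prop) (a * b) (ae_of_all _ fun z => ?_)
  rw [Real.norm_eq_abs, abs_mul]
  exact mul_le_mul (ha _) (hb _) (abs_nonneg _) ((abs_nonneg _).trans (ha z.1))

theorem BddMeas.ip_op (π : Measure X) [IsFiniteMeasure π] (κ : Kernel X X) [IsMarkovKernel κ]
    (f g : BddMeas X) :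
    BddMeas.ip π f (BddMeas.op κ g) = ∫ z, f.1 z.1 * g.1 z.2 ∂(π ⊗ₘ κ) := by
  rw [Measure.integral_compProd (BddMeas.integrable_compProd π κ f g), BddMeas.ip_apply]
  simp only [BddMeas.op_apply, integral_const_mul]

theorem BddMeas.ip_comm (π : Measure X) [IsFiniteMeasure π] (f g : BddMeas X) :
    BddMeas.ip π f g = BddMeas.ip π g f := by
  simp only [BddMeas.ip_apply, mul_comm]

theorem BddMeas.ip_op_comm {π : Measure X} [IsFiniteMeasure π] {κ : Kernel X X} [IsMarkovKernel κ]
    (hκ : κ.IsReversible π) (f g : BddMeas X) :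
    BddMeas.ip π (BddMeas.op κ f) g = BddMeas.ip π f (BddMeas.op κ g) := by
  rw [BddMeas.ip_comm, BddMeas.ip_op, BddMeas.ip_op, ← map_swap_compProd hκ]
  rw [integral_map measurable_swap.aemeasurable]
  · simp only [Prod.fst_swap, Prod.snd_swap, mul_comm, map_swap_compProd hκ]
  · obtain ⟨hf, -⟩ := f.2
    obtain ⟨hg, -⟩ := g.2
    exact Measurable.aestronglyMeasurable (by fun_prop)

/-- A kernel minorized on `C` by `β π` has joint stationary law minorized on `C × C`. -/
theorem smul_prod_le_compProd {π : Measure X} [IsFiniteMeasure π] {κ : Kernel X X}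
    [IsMarkovKernel κ] {C : Set X} (hC : MeasurableSet C) {b : ℝ≥0∞}
    (h : ∀ x ∈ C, b • π.restrict C ≤ κ x) :
    b • (π.restrict C).prod (π.restrict C) ≤ π ⊗ₘ κ := by
  refine Measure.le_iff.2 fun s hs => ?_
  rw [Measure.smul_apply, Measure.prod_apply hs, Measure.compProd_apply hs, smul_eq_mul,
    ← lintegral_const_mul _ (measurable_measure_prodMk_left hs)]
  refine (setLIntegral_mono' hC fun x hx => ?_).trans (setLIntegral_le_lintegral C _)
  exact h x hx _

theorem BddMeas.ip_ind (π : Measure X) [IsFiniteMeasure π] {C : Set X} (hC : MeasurableSet C)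
    (f : BddMeas X) : BddMeas.ip π (BddMeas.ind hC) f = ∫ x in C, f.1 x ∂π := by
  rw [BddMeas.ip_apply, ← integral_indicator hC]
  congr 1 with x
  by_cases h : x ∈ C <;> simp [BddMeas.ind, h]

theorem integral_compProd_swap {π : Measure X} [IsFiniteMeasure π] {κ : Kernel X X}
    [IsMarkovKernel κ] (hκ : κ.IsReversible π) {F : X × X → ℝ} (hF : Measurable F) :
    ∫ z, F z.swap ∂(π ⊗ₘ κ) = ∫ z, F z ∂(π ⊗ₘ κ) := by
  conv_rhs => rw [← map_swap_compProd hκ]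
  rw [integral_map measurable_swap.aemeasurable hF.aestronglyMeasurable]

theorem integrable_compProd_swap {π : Measure X} [IsFiniteMeasure π] {κ : Kernel X X}
    [IsMarkovKernel κ] (hκ : κ.IsReversible π) {F : X × X → ℝ} (hF : Measurable F)
    (hi : Integrable F (π ⊗ₘ κ)) : Integrable (fun z => F z.swap) (π ⊗ₘ κ) := by
  rw [← map_swap_compProd hκ] at hi
  exact (integrable_map_measure hF.aestronglyMeasurable measurable_swap.aemeasurable).1 hi

/-- Schur test: a drift inequality for a reversible kernel, up to a rank-one minorization, bounds
its quadratic form up to that rank-one term. -/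
theorem ip_op_le_of_drift {π : Measure X} [IsFiniteMeasure π] {κ : Kernel X X} [IsMarkovKernel κ]
    (hκ : κ.IsReversible π) {C : Set X} (hC : MeasurableSet C) {β : ℝ} (hβ : 0 ≤ β)
    (hmin : ∀ x ∈ C, ENNReal.ofReal β • π.restrict C ≤ κ x) {W : X → ℝ} (hW : Measurable W)
    (hW1 : ∀ x, 1 ≤ W x) {w : ℝ} (hWC : ∀ x ∈ C, W x ≤ w) (hWi : ∀ x, Integrable W (κ x))
    {r : ℝ}
    (hdrift : ∀ x, ∫ y, W y ∂κ x ≤ r * W x + C.indicator (fun _ => β * ∫ y in C, W y ∂π) x)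
    (f : BddMeas X) :
    BddMeas.ip π f (BddMeas.op κ f)
      ≤ r * BddMeas.ip π f f + β * BddMeas.ip π (BddMeas.ind hC) f ^ 2 := by
  obtain ⟨hf, a, ha⟩ := f.2
  have hW0 : ∀ x, 0 < W x := fun x => one_pos.trans_le (hW1 x)
  set D : ℝ := β * ∫ y in C, W y ∂π with hD
  have hD0 : 0 ≤ D := mul_nonneg hβ (integral_nonneg fun x => (hW0 x).le)
  have hWCi : Integrable W (π.restrict C) := by
    refine Integrable.of_bound hW.aestronglyMeasurable w ?_
    filter_upwards [ae_restrict_mem hC] with x hx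
    rw [Real.norm_of_nonneg (hW0 x).le]
    exact hWC x hx
  have hgb : ∀ x, f.1 x ^ 2 / W x ≤ a ^ 2 := fun x =>
    (div_le_self (sq_nonneg _) (hW1 x)).trans (sq_le_sq.2 ((ha x).trans (le_abs_self a)))
  have hg0 : ∀ x, 0 ≤ f.1 x ^ 2 / W x := fun x => div_nonneg (sq_nonneg _) (hW0 x).le
  let g : BddMeas X := ⟨fun x => f.1 x ^ 2 / W x, by fun_prop, a ^ 2, fun x => by
    rw [abs_of_nonneg (hg0 x)]; exact hgb x⟩
  -- The weighted inequality `2 f(x) f(y) ≤ f(x)² W(y) / W(x) + f(y)² W(x) / W(y)`; the right-hand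
  -- terms are `t` and its swap, with equal integrals by reversibility.
  let t : X × X → ℝ := fun z => f.1 z.1 ^ 2 / W z.1 * W z.2
  have htm : Measurable t := by fun_prop
  have ht0 : ∀ z, 0 ≤ t z := fun z => mul_nonneg (hg0 _) (hW0 _).le
  have hKle : ∀ x, f.1 x ^ 2 / W x * ∫ y, W y ∂κ x ≤ r * f.1 x ^ 2 + D * C.indicator g.1 x := by
    intro x
    refine (mul_le_mul_of_nonneg_left (hdrift x) (hg0 x)).trans (le_of_eq ?_)
    have := (hW0 x).ne'
    by_cases h : x ∈ C
    · simp only [Set.indicator_of_mem h, g]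
      field_simp
    · simp only [Set.indicator_of_notMem h]
      field_simp
      ring
  have hRi : Integrable (fun x => r * f.1 x ^ 2 + D * C.indicator g.1 x) π := by
    refine Integrable.add (Integrable.const_mul ?_ _)
      (((BddMeas.integrable g π).indicator hC).const_mul _)
    simpa only [sq] using BddMeas.integrable_mul f f π
  have hti : Integrable t (π ⊗ₘ κ) := by
    rw [Measure.integrable_compProd_iff htm.aestronglyMeasurable]
    refine ⟨ae_of_all _ fun x => (hWi x).const_mul (f.1 x ^ 2 / W x), hRi.mono' ?_ (ae_of_all _ fun x => ?_)⟩
    · exact (htm.norm.stronglyMeasurable.integral_kernel_prod_right').aestronglyMeasurable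
    · rw [Real.norm_of_nonneg (integral_nonneg fun _ => norm_nonneg _)]
      simp only [Real.norm_of_nonneg (ht0 _)]
      simp only [t, integral_const_mul]
      exact hKle x
  have hts := integrable_compProd_swap hκ htm hti
  have hff := BddMeas.integrable_compProd π κ f f
  let h : X × X → ℝ := fun z => 2⁻¹ * (t z + t z.swap) - f.1 z.1 * f.1 z.2
  have hh0 : ∀ z, 0 ≤ h z := by
    intro z
    have h1 := (hW0 z.1)
    have h2 := (hW0 z.2)
    have : h z = 2⁻¹ * (W z.1 * W z.2) * (f.1 z.1 / W z.1 - f.1 z.2 / W z.2) ^ 2 := by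
      simp only [h, t, Prod.fst_swap, Prod.snd_swap]
      field_simp
      ring
    rw [this]
    positivity
  have hhi : Integrable h (π ⊗ₘ κ) := ((hti.add hts).const_mul _).sub hff
  have e1 : ∫ z, h z ∂(π ⊗ₘ κ) = ∫ x, f.1 x ^ 2 / W x * ∫ y, W y ∂κ x ∂π
      - BddMeas.ip π f (BddMeas.op κ f) := by
    have i4 : Integrable (fun z => 2⁻¹ * (t z + t z.swap)) (π ⊗ₘ κ) := (hti.add hts).const_mul _
    simp only [h]
    rw [integral_sub i4 hff, ← BddMeas.ip_op, integral_const_mul,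
      integral_add hti hts, integral_compProd_swap hκ htm, Measure.integral_compProd hti]
    simp only [t, integral_const_mul]
    ring
  have e2 : ∫ z, h z ∂((π.restrict C).prod (π.restrict C))
      = (∫ x in C, g.1 x ∂π) * (∫ x in C, W x ∂π) - (∫ x in C, f.1 x ∂π) ^ 2 := by
    have i1 : Integrable t ((π.restrict C).prod (π.restrict C)) :=
      (BddMeas.integrable g _).mul_prod hWCi
    have i2 : Integrable (fun z => t z.swap) ((π.restrict C).prod (π.restrict C)) := i1.swap
    have i3 : Integrable (fun z : X × X => f.1 z.1 * f.1 z.2)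
      ((π.restrict C).prod (π.restrict C)) :=
      (BddMeas.integrable f _).mul_prod (BddMeas.integrable f _)
    have i4 : Integrable (fun z => 2⁻¹ * (t z + t z.swap))
      ((π.restrict C).prod (π.restrict C)) := (i1.add i2).const_mul _
    simp only [h]
    rw [integral_sub i4 i3, integral_const_mul, integral_add i1 i2,
      integral_prod_swap, integral_prod_mul (fun x => f.1 x) (fun x => f.1 x)]
    have : ∫ z, t z ∂((π.restrict C).prod (π.restrict C))
        = (∫ x in C, g.1 x ∂π) * (∫ x in C, W x ∂π) :=
      integral_prod_mul g.1 W
    rw [this]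
    ring
  -- The nonnegative gap `h` is not discarded: its mass on the minorizing part of the joint law is
  -- kept. The product of the integrals of `g` and `W` there, times `β`, cancels exactly the excess
  -- term of the drift inequality in `e4`, leaving only the rank-one square.
  have e3 : β * ∫ z, h z ∂((π.restrict C).prod (π.restrict C)) ≤ ∫ z, h z ∂(π ⊗ₘ κ) := by
    have := integral_mono_measure (smul_prod_le_compProd hC hmin) (ae_of_all _ hh0) hhi
    rwa [integral_smul_measure, ENNReal.toReal_ofReal hβ, smul_eq_mul] at this
  have e4 : ∫ x, f.1 x ^ 2 / W x * ∫ y, W y ∂κ x ∂π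
      ≤ r * BddMeas.ip π f f + D * ∫ x in C, g.1 x ∂π := by
    have : r * BddMeas.ip π f f + D * ∫ x in C, g.1 x ∂π
        = ∫ x, (r * f.1 x ^ 2 + D * C.indicator g.1 x) ∂π := by
      rw [integral_add, integral_const_mul, integral_const_mul, integral_indicator hC,
        BddMeas.ip_apply]
      · simp only [sq]
      · refine Integrable.const_mul ?_ _
        simpa only [sq] using BddMeas.integrable_mul f f π
      · exact ((BddMeas.integrable g π).indicator hC).const_mul _
    rw [this]
    refine integral_mono_of_nonneg (ae_of_all _ fun x => ?_) hRi (ae_of_all _ hKle)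
    exact mul_nonneg (hg0 x) (integral_nonneg fun y => (hW0 y).le)
  rw [e1, e2] at e3
  rw [BddMeas.ip_ind]
  nlinarith [e3, e4, hD]

/-- The Dirichlet form of a reversible kernel. -/
theorem integral_sub_sq_compProd {π : Measure X} [IsFiniteMeasure π] {κ : Kernel X X}
    [IsMarkovKernel κ] (hκ : κ.IsReversible π) (f : BddMeas X) :
    Integrable (fun z : X × X => (f.1 z.1 - f.1 z.2) ^ 2) (π ⊗ₘ κ) ∧
    ∫ z, (f.1 z.1 - f.1 z.2) ^ 2 ∂(π ⊗ₘ κ)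
      = 2 * (BddMeas.ip π f f - BddMeas.ip π f (BddMeas.op κ f)) := by
  obtain ⟨hf, a, ha⟩ := f.2
  let F : BddMeas X := ⟨fun x => f.1 x * f.1 x, hf.mul hf, a * a, fun x => by
    rw [abs_mul]
    exact mul_le_mul (ha x) (ha x) (abs_nonneg _) ((abs_nonneg _).trans (ha x))⟩
  have i1 := BddMeas.integrable_compProd π κ F BddMeas.one
  have i2 := BddMeas.integrable_compProd π κ BddMeas.one F
  have i3 := BddMeas.integrable_compProd π κ f f
  have e : (fun z : X × X => (f.1 z.1 - f.1 z.2) ^ 2) = fun z =>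
      F.1 z.1 * (BddMeas.one : BddMeas X).1 z.2 + (BddMeas.one : BddMeas X).1 z.1 * F.1 z.2
        - 2 * (f.1 z.1 * f.1 z.2) := by
    ext z
    simp only [F, BddMeas.one]
    ring
  have e0 : BddMeas.ip π F BddMeas.one = BddMeas.ip π f f := by
    simp [BddMeas.ip_apply, F, BddMeas.one]
  have i4 : Integrable (fun z : X × X => F.1 z.1 * (BddMeas.one : BddMeas X).1 z.2
      + (BddMeas.one : BddMeas X).1 z.1 * F.1 z.2) (π ⊗ₘ κ) := i1.add i2
  rw [e]
  refine ⟨i4.sub (i3.const_mul 2), ?_⟩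
  rw [integral_sub i4 (i3.const_mul 2), integral_add i1 i2, integral_const_mul,
    ← BddMeas.ip_op, ← BddMeas.ip_op, ← BddMeas.ip_op, ← BddMeas.ip_op_comm hκ BddMeas.one,
    BddMeas.op_one, BddMeas.ip_comm π BddMeas.one, e0]
  ring

/-- Comparison of Dirichlet forms. -/
theorem dirichlet_le {π : Measure X} [IsFiniteMeasure π] {κ η : Kernel X X} [IsMarkovKernel κ]
    [IsMarkovKernel η] (hκ : κ.IsReversible π) (hη : η.IsReversible π) {c : ℝ} (hc : 0 ≤ c)
    (h : ∀ x, ENNReal.ofReal c • η x ≤ κ x) (f : BddMeas X) :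
    c * (BddMeas.ip π f f - BddMeas.ip π f (BddMeas.op η f))
      ≤ BddMeas.ip π f f - BddMeas.ip π f (BddMeas.op κ f) := by
  have hle : ENNReal.ofReal c • (π ⊗ₘ η) ≤ π ⊗ₘ κ := by
    refine Measure.le_iff.2 fun s hs => ?_
    rw [Measure.smul_apply, Measure.compProd_apply hs, Measure.compProd_apply hs, smul_eq_mul,
      ← lintegral_const_mul _ (Kernel.measurable_kernel_prodMk_left hs)]
    exact lintegral_mono fun x => h x _
  obtain ⟨i1, e1⟩ := integral_sub_sq_compProd hκ f
  obtain ⟨-, e2⟩ := integral_sub_sq_compProd hη f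
  have := integral_mono_measure hle (ae_of_all _ fun z => sq_nonneg _) i1
  rw [integral_smul_measure, ENNReal.toReal_ofReal hc, smul_eq_mul, e1, e2] at this
  linarith

end Chain

/-! ### The residual operator left after removing the minorizing part -/

section Chain

variable {X : Type*} [MeasurableSpace X]

/-- The operator `κ` with its minorizing part `β 1_C ⊗ 1_C π` removed. -/
noncomputable def BddMeas.resid (π : Measure X) [IsFiniteMeasure π] (κ : Kernel X X)
    [IsMarkovKernel κ] {C : Set X} (hC : MeasurableSet C) (β : ℝ) : BddMeas X →ₗ[ℝ] BddMeas X :=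
  BddMeas.op κ - β • (BddMeas.ip π (BddMeas.ind hC)).smulRight (BddMeas.ind hC)

variable {π : Measure X} [IsFiniteMeasure π] {κ : Kernel X X} [IsMarkovKernel κ] {C : Set X}
  {hC : MeasurableSet C} {β : ℝ}

theorem BddMeas.op_eq_resid_add (f : BddMeas X) :
    BddMeas.op κ f = BddMeas.resid π κ hC β f
      + (β * BddMeas.ip π (BddMeas.ind hC) f) • BddMeas.ind hC := by
  simp [BddMeas.resid, mul_smul]

/-- The minorization says that the removed part is dominated by `κ`, so a positive operator remains.
Every pointwise bound on its powers rests on this. -/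
theorem BddMeas.resid_nonneg (hβ : 0 ≤ β)
    (hmin : ∀ x ∈ C, ENNReal.ofReal β • π.restrict C ≤ κ x) {f : BddMeas X}
    (hf : ∀ x, 0 ≤ f.1 x) (x : X) : 0 ≤ (BddMeas.resid π κ hC β f).1 x := by
  have h1 : (BddMeas.resid π κ hC β f).1 x = ∫ y, f.1 y ∂κ x
      - β * ((BddMeas.ip π (BddMeas.ind hC) f) * C.indicator (fun _ => 1) x) := rfl
  rw [h1]
  by_cases h : x ∈ C
  · have := integral_mono_measure (hmin x h) (ae_of_all _ hf) (BddMeas.integrable f _)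
    rw [integral_smul_measure, ENNReal.toReal_ofReal hβ, smul_eq_mul] at this
    rw [BddMeas.ip_ind, Set.indicator_of_mem h, mul_one]
    linarith
  · simpa [h] using integral_nonneg hf

theorem BddMeas.resid_mono (hβ : 0 ≤ β)
    (hmin : ∀ x ∈ C, ENNReal.ofReal β • π.restrict C ≤ κ x) {f g : BddMeas X}
    (hfg : ∀ x, f.1 x ≤ g.1 x) (x : X) :
    (BddMeas.resid π κ hC β f).1 x ≤ (BddMeas.resid π κ hC β g).1 x := by
  have := BddMeas.resid_nonneg (hC := hC) hβ hmin (f := g - f) (fun x => sub_nonneg.2 (hfg x)) x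
  rw [map_sub] at this
  exact sub_nonneg.1 this

theorem BddMeas.resid_pow_mono (hβ : 0 ≤ β)
    (hmin : ∀ x ∈ C, ENNReal.ofReal β • π.restrict C ≤ κ x) (n : ℕ) {f g : BddMeas X}
    (hfg : ∀ x, f.1 x ≤ g.1 x) (x : X) :
    ((BddMeas.resid π κ hC β ^ n) f).1 x ≤ ((BddMeas.resid π κ hC β ^ n) g).1 x := by
  induction n generalizing x with
  | zero => exact hfg x
  | succ n ih =>
    rw [pow_succ', Module.End.mul_apply, Module.End.mul_apply]
    exact BddMeas.resid_mono hβ hmin ih x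

theorem BddMeas.abs_resid_pow_le (hβ : 0 ≤ β)
    (hmin : ∀ x ∈ C, ENNReal.ofReal β • π.restrict C ≤ κ x) (n : ℕ) {f g : BddMeas X}
    (hfg : ∀ x, |f.1 x| ≤ g.1 x) (x : X) :
    |((BddMeas.resid π κ hC β ^ n) f).1 x| ≤ ((BddMeas.resid π κ hC β ^ n) g).1 x := by
  rw [abs_le]
  constructor
  · have := BddMeas.resid_pow_mono (hC := hC) hβ hmin n (f := -g) (g := f)
      (fun x => (abs_le.1 (hfg x)).1) x
    rwa [map_neg] at this
  · exact BddMeas.resid_pow_mono hβ hmin n (fun x => (abs_le.1 (hfg x)).2) x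

theorem BddMeas.ip_resid (f g : BddMeas X) :
    BddMeas.ip π f (BddMeas.resid π κ hC β g) = BddMeas.ip π f (BddMeas.op κ g)
      - β * (BddMeas.ip π (BddMeas.ind hC) f * BddMeas.ip π (BddMeas.ind hC) g) := by
  simp only [BddMeas.resid, LinearMap.sub_apply, LinearMap.smul_apply, LinearMap.smulRight_apply,
    map_sub, map_smul, smul_eq_mul, BddMeas.ip_comm π f (BddMeas.ind hC)]
  ring

theorem BddMeas.ip_resid_comm (hκ : κ.IsReversible π) (f g : BddMeas X) :
    BddMeas.ip π (BddMeas.resid π κ hC β f) g = BddMeas.ip π f (BddMeas.resid π κ hC β g) := by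
  rw [BddMeas.ip_comm, BddMeas.ip_resid, BddMeas.ip_resid, ← BddMeas.ip_op_comm hκ f g,
    BddMeas.ip_comm π (BddMeas.op κ f)]
  ring

/-- Positivity upgrades a one-sided bound to a two-sided one: replacing `f` by `|f|` keeps the norm
and can only increase the modulus of the form. Hence the bottom of the spectrum needs no separate
argument. -/
theorem BddMeas.abs_ip_resid_le (hβ : 0 ≤ β)
    (hmin : ∀ x ∈ C, ENNReal.ofReal β • π.restrict C ≤ κ x) {r : ℝ}
    (h : ∀ f, BddMeas.ip π f (BddMeas.resid π κ hC β f) ≤ r * BddMeas.ip π f f) (f : BddMeas X) :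
    |BddMeas.ip π f (BddMeas.resid π κ hC β f)| ≤ r * BddMeas.ip π f f := by
  have h1 := h (BddMeas.abs f)
  have h2 : BddMeas.ip π (BddMeas.abs f) (BddMeas.abs f) = BddMeas.ip π f f := by
    simp [BddMeas.ip_apply, BddMeas.abs]
  rw [h2] at h1
  refine le_trans ?_ h1
  rw [BddMeas.ip_apply, BddMeas.ip_apply]
  refine (abs_integral_le_integral_abs).trans (integral_mono
    (BddMeas.integrable_mul f _ π).abs (BddMeas.integrable_mul _ _ π) fun x => ?_)
  simp only [abs_mul]
  exact mul_le_mul_of_nonneg_left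
    (BddMeas.abs_resid_pow_le hβ hmin 1 (g := BddMeas.abs f) (fun _ => le_rfl) x) (abs_nonneg _)

theorem BddMeas.ip_pow_apply_le {T : BddMeas X →ₗ[ℝ] BddMeas X} {r : ℝ}
    {S : Submodule ℝ (BddMeas X)} (hS : ∀ f ∈ S, T f ∈ S)
    (h : ∀ f ∈ S, BddMeas.ip π (T f) (T f) ≤ r ^ 2 * BddMeas.ip π f f) {f : BddMeas X}
    (hf : f ∈ S) (n : ℕ) :
    BddMeas.ip π ((T ^ n) f) ((T ^ n) f) ≤ (r ^ n) ^ 2 * BddMeas.ip π f f := by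
  have key : (T ^ n) f ∈ S ∧
      BddMeas.ip π ((T ^ n) f) ((T ^ n) f) ≤ (r ^ n) ^ 2 * BddMeas.ip π f f := by
    induction n with
    | zero => exact ⟨hf, by simp⟩
    | succ n ih =>
      rw [pow_succ', Module.End.mul_apply]
      refine ⟨hS _ ih.1, (h _ ih.1).trans ?_⟩
      calc _ ≤ r ^ 2 * ((r ^ n) ^ 2 * BddMeas.ip π f f) :=
            mul_le_mul_of_nonneg_left ih.2 (sq_nonneg r)
        _ = _ := by ring
  exact key.2

end Chain

/-! ### From quadratic forms to almost-everywhere geometric convergence -/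

section GeometricBound

variable {X : Type*} [MeasurableSpace X] {π : Measure X} [IsProbabilityMeasure π]
  {κ : Kernel X X} [IsMarkovKernel κ] {C : Set X} {hC : MeasurableSet C} {β : ℝ}

/-- Cauchy–Schwarz against an indicator of norm at most one, obtained from `|f| ≤ (a² + f²) / (2
a)`. -/
theorem BddMeas.abs_ip_ind_le (f : BddMeas X) {a : ℝ} (ha : 0 < a)
    (h : BddMeas.ip π f f ≤ a ^ 2) : |BddMeas.ip π (BddMeas.ind hC) f| ≤ a := by
  have i1 := BddMeas.integrable_mul f f π
  have h1 : |BddMeas.ip π (BddMeas.ind hC) f| ≤ ∫ x, (a ^ 2 + f.1 x * f.1 x) / (2 * a) ∂π := by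
    rw [BddMeas.ip_apply]
    refine abs_integral_le_integral_abs.trans (integral_mono
      (BddMeas.integrable_mul _ f π).abs (((integrable_const _).add i1).div_const _) fun x => ?_)
    have h2 : |f.1 x| ≤ (a ^ 2 + f.1 x * f.1 x) / (2 * a) := by
      rw [le_div_iff₀ (by positivity)]
      nlinarith [sq_nonneg (|f.1 x| - a), abs_mul_abs_self (f.1 x)]
    refine le_trans ?_ h2
    by_cases hx : x ∈ C <;> simp [BddMeas.ind, hx]
  refine h1.trans ?_
  rw [integral_div, integral_add (integrable_const _) i1, ← BddMeas.ip_apply,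
    div_le_iff₀ (by positivity)]
  simp
  linarith

/-- A reversible kernel whose quadratic form is a strict contraction up to a minorizing rank-one
term converges geometrically in total variation from almost every starting point. -/
theorem ae_exists_geometric_bound (hκ : κ.IsReversible π)
    (hC : MeasurableSet C) (hC0 : π C ≠ 0) (hβ : 0 ≤ β)
    (hmin : ∀ x ∈ C, ENNReal.ofReal β • π.restrict C ≤ κ x) {r ρ : ℝ} (hr : 0 < r) (hrρ : r < ρ)
    (hρ : ρ < 1)
    (h : ∀ f, BddMeas.ip π f (BddMeas.op κ f)
      ≤ r * BddMeas.ip π f f + β * BddMeas.ip π (BddMeas.ind hC) f ^ 2) :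
    ∀ᵐ x ∂π, ∃ c : ℝ, ∀ (n : ℕ) (f : X → ℝ), Measurable f → (∀ y, |f y| ≤ 1) →
      |∫ y, f y ∂(κ ^ n) x - ∫ y, f y ∂π| ≤ c * ρ ^ n := by
  have hB : ∀ f, |BddMeas.ip π f (BddMeas.resid π κ hC β f)| ≤ r * BddMeas.ip π f f :=
    BddMeas.abs_ip_resid_le hβ hmin fun f => by
      rw [BddMeas.ip_resid]
      linarith [h f, sq (BddMeas.ip π (BddMeas.ind hC) f)]
  have h1 : BddMeas.ip π BddMeas.one BddMeas.one = 1 := by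
    simp [BddMeas.ip_apply, BddMeas.one]
  -- decay of the residual operator
  have hdec : ∀ n : ℕ, BddMeas.ip π ((BddMeas.resid π κ hC β ^ n) BddMeas.one)
      ((BddMeas.resid π κ hC β ^ n) BddMeas.one) ≤ (r ^ n) ^ 2 := by
    intro n
    have := BddMeas.ip_pow_apply_le (π := π) (T := BddMeas.resid π κ hC β) (S := ⊤) (r := r)
      (fun f _ => trivial) (fun f hf => apply_sq_le_of_numericalRadius_le (BddMeas.ip π)
        (BddMeas.ip_comm π) _ (BddMeas.ip_resid_comm hκ) ⊤ (fun f _ => trivial) hr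
        (fun f _ => hB f) hf) (f := BddMeas.one) trivial n
    rwa [h1, mul_one] at this
  -- decay of the kernel on centered functions
  let S : Submodule ℝ (BddMeas X) := LinearMap.ker (BddMeas.ip π BddMeas.one)
  have hS : ∀ f ∈ S, BddMeas.op κ f ∈ S := by
    intro f hf
    rw [LinearMap.mem_ker] at hf ⊢
    rw [← BddMeas.ip_op_comm hκ, BddMeas.op_one, hf]
  have hind : BddMeas.ip π (BddMeas.ind hC) BddMeas.one ≠ 0 := by
    rw [BddMeas.ip_ind]
    simp [BddMeas.one, Measure.real, ENNReal.toReal_eq_zero_iff, hC0]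
  have hcen : ∀ f ∈ S, BddMeas.ip π (BddMeas.op κ f) (BddMeas.op κ f)
      ≤ r ^ 2 * BddMeas.ip π f f := by
    intro f hf
    refine apply_sq_le_of_numericalRadius_le (BddMeas.ip π) (BddMeas.ip_comm π) _
      (BddMeas.ip_op_comm hκ) S hS hr (fun g hg => ?_) hf
    refine abs_ip_le_of_rankOne (BddMeas.ip π) (BddMeas.ip_comm π) _ (BddMeas.ip_op_comm hκ)
      (BddMeas.op_one κ) h1 hind hβ (hrρ.trans hρ).le (fun g => ?_) ?_
    · have := hB g
      rwa [BddMeas.ip_resid, ← sq] at this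
    · rw [BddMeas.ip_comm]
      exact hg
  have hρ0 : 0 < ρ := hr.trans hrρ
  -- pointwise decay of the residual operator
  have hae : ∀ᵐ x ∂π, ∃ c : ℝ, 0 ≤ c ∧
      ∀ n : ℕ, ((BddMeas.resid π κ hC β ^ n) BddMeas.one).1 x ≤ c * ρ ^ n := by
    let u : ℕ → X → ℝ := fun n x =>
      (((BddMeas.resid π κ hC β ^ n) BddMeas.one).1 x / ρ ^ n) ^ 2
    have hum : ∀ n, Measurable (u n) := fun n =>
      (((BddMeas.resid π κ hC β ^ n) BddMeas.one).2.1.div_const _).pow_const 2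
    -- The L² norms of the residual iterates are at most `r ^ n`, so rescaling by `ρ ^ n` with `ρ >
    -- r` gives a summable series of squares; it is finite at almost every point, and each term is
    -- bounded by the sum.
    have hsum : ∫⁻ x, ∑' n, ENNReal.ofReal (u n x) ∂π ≠ ∞ := by
      rw [lintegral_tsum fun n => (hum n).ennreal_ofReal.aemeasurable]
      have hle : ∀ n, ∫⁻ x, ENNReal.ofReal (u n x) ∂π ≤ ENNReal.ofReal (((r / ρ) ^ 2) ^ n) := by
        intro n
        have hui : Integrable (u n) π := by
          have := (BddMeas.integrable_mul ((BddMeas.resid π κ hC β ^ n) BddMeas.one)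
            ((BddMeas.resid π κ hC β ^ n) BddMeas.one) π).div_const ((ρ ^ n) ^ 2)
          refine this.congr (ae_of_all _ fun x => ?_)
          simp only [u, div_pow, ← sq]
        rw [← ofReal_integral_eq_lintegral_ofReal hui (ae_of_all _ fun x => sq_nonneg _)]
        refine ENNReal.ofReal_le_ofReal ?_
        have : ∫ x, u n x ∂π = BddMeas.ip π ((BddMeas.resid π κ hC β ^ n) BddMeas.one)
            ((BddMeas.resid π κ hC β ^ n) BddMeas.one) / (ρ ^ n) ^ 2 := by
          rw [BddMeas.ip_apply, ← integral_div]
          simp only [u, div_pow, ← sq]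
        rw [this, pow_right_comm (r / ρ) 2 n, div_pow, div_pow]
        exact div_le_div_of_nonneg_right (hdec n) (by positivity)
      refine ne_top_of_le_ne_top ?_ (ENNReal.tsum_le_tsum hle)
      rw [← ENNReal.ofReal_tsum_of_nonneg (fun n => by positivity)]
      · exact ENNReal.ofReal_ne_top
      · refine summable_geometric_of_lt_one (by positivity) ?_
        rw [sq_lt_one_iff₀ (by positivity), div_lt_one hρ0]
        exact hrρ
    filter_upwards [ae_lt_top (Measurable.tsum fun n => (hum n).ennreal_ofReal) hsum]
      with x hx
    refine ⟨√(∑' n, ENNReal.ofReal (u n x)).toReal, Real.sqrt_nonneg _, fun n => ?_⟩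
    rw [← div_le_iff₀ (by positivity)]
    refine Real.le_sqrt_of_sq_le ?_
    rw [← ENNReal.ofReal_le_iff_le_toReal hx.ne]
    exact ENNReal.le_tsum n
  filter_upwards [hae] with x ⟨c, hc0, hc⟩
  -- Chosen so that `D (ρ - r) = β`, which gives the convolution of `r ^ n` with `ρ ^ n` a closed
  -- form and makes the induction in `key` close with equality.
  set D : ℝ := β / (ρ - r) with hD
  have hD0 : 0 ≤ D := div_nonneg hβ (sub_nonneg.2 hrρ.le)
  have hDβ : D * (ρ - r) = β := div_mul_cancel₀ _ (sub_pos.2 hrρ).ne'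
  refine ⟨2 * c * (1 + D), fun n f hf hf1 => ?_⟩
  let g : BddMeas X := ⟨f, hf, 1, hf1⟩
  let f0 : BddMeas X := g - (∫ y, f y ∂π) • BddMeas.one
  have hm : |∫ y, f y ∂π| ≤ 1 := by
    simpa using norm_integral_le_of_norm_le_const (μ := π) (f := f) (ae_of_all _ hf1)
  have hf0 : ∀ y, |f0.1 y| ≤ 2 := by
    intro y
    have : f0.1 y = f y - (∫ y, f y ∂π) * 1 := rfl
    rw [this, mul_one]
    exact (abs_sub _ _).trans (by linarith [hf1 y])
  have hf0S : f0 ∈ S := by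
    rw [LinearMap.mem_ker, map_sub, map_smul, h1, BddMeas.ip_apply]
    simp [BddMeas.one, g]
  have hpos : ∀ n : ℕ, |BddMeas.ip π (BddMeas.ind hC) ((BddMeas.op κ ^ n) f0)| ≤ 2 * r ^ n := by
    intro n
    refine BddMeas.abs_ip_ind_le _ (by positivity) ?_
    refine (BddMeas.ip_pow_apply_le hS hcen hf0S n).trans ?_
    have : BddMeas.ip π f0 f0 ≤ 4 := by
      rw [BddMeas.ip_apply]
      refine (integral_mono (BddMeas.integrable_mul f0 f0 π) (integrable_const 4)
        fun y => ?_).trans (by simp)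
      have := abs_le.1 (hf0 y)
      change f0.1 y * f0.1 y ≤ 4
      nlinarith
    nlinarith [sq_nonneg (r ^ n)]
  -- The extra `k` is needed because splitting one factor of the kernel into residual plus rank one
  -- turns `(n + 1, k)` into `(n, k + 1)` and a multiple of the `k`-th residual iterate of `1_C`.
  -- The multiple is small by L² decay, the iterate by pointwise decay at `x`. The constant depends
  -- on `x` but not on `f`.
  have key : ∀ n k : ℕ, |((BddMeas.resid π κ hC β ^ k) ((BddMeas.op κ ^ n) f0)).1 x|
      ≤ 2 * c * ρ ^ k * (ρ ^ n + D * (ρ ^ n - r ^ n)) := by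
    intro n
    induction n with
    | zero =>
      intro k
      have := BddMeas.abs_resid_pow_le (hC := hC) hβ hmin k (f := f0)
        (g := (2 : ℝ) • BddMeas.one) (fun y => by
          change _ ≤ (2 : ℝ) * 1
          simpa using hf0 y) x
      simp only [pow_zero, Module.End.one_apply, sub_self, mul_zero, add_zero, mul_one]
      refine this.trans ?_
      rw [map_smul]
      change 2 * ((BddMeas.resid π κ hC β ^ k) BddMeas.one).1 x ≤ _
      linarith [hc k]
    | succ n ih =>
      intro k
      have e : ((BddMeas.resid π κ hC β ^ k) ((BddMeas.op κ ^ (n + 1)) f0)).1 x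
          = ((BddMeas.resid π κ hC β ^ (k + 1)) ((BddMeas.op κ ^ n) f0)).1 x
            + (β * BddMeas.ip π (BddMeas.ind hC) ((BddMeas.op κ ^ n) f0))
              * ((BddMeas.resid π κ hC β ^ k) (BddMeas.ind hC)).1 x := by
        rw [pow_succ' (BddMeas.op κ), Module.End.mul_apply,
          BddMeas.op_eq_resid_add (π := π) (hC := hC) (β := β), map_add, map_smul, pow_succ,
          Module.End.mul_apply]
        rfl
      rw [e]
      have h3 : |((BddMeas.resid π κ hC β ^ k) (BddMeas.ind hC)).1 x| ≤ c * ρ ^ k :=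
        (BddMeas.abs_resid_pow_le hβ hmin k (g := BddMeas.one) (fun y => by
          by_cases hy : y ∈ C <;> simp [BddMeas.ind, BddMeas.one, hy]) x).trans (hc k)
      refine (abs_add_le _ _).trans ((add_le_add (d := β * (2 * r ^ n) * (c * ρ ^ k))
        (ih (k + 1)) ?_).trans (le_of_eq ?_))
      · rw [abs_mul, abs_mul, abs_of_nonneg hβ]
        exact mul_le_mul (mul_le_mul_of_nonneg_left (hpos n) hβ) h3 (abs_nonneg _) (by positivity)
      · rw [← hDβ]
        ring
  have hfin := key n 0
  have e : ((BddMeas.op κ ^ n) f0).1 x = ∫ y, f y ∂(κ ^ n) x - ∫ y, f y ∂π := by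
    have h2 : (BddMeas.op κ ^ n) (BddMeas.one : BddMeas X) = BddMeas.one := by
      induction n with
      | zero => rfl
      | succ n ih =>
        rw [pow_succ, Module.End.mul_apply, BddMeas.op_one, ih (key n 0)]
    rw [map_sub, map_smul, h2]
    change ((BddMeas.op κ ^ n) g).1 x - (∫ y, f y ∂π) * 1 = _
    rw [BddMeas.op_pow_apply, mul_one]
  rw [pow_zero, pow_zero, Module.End.one_apply, e] at hfin
  refine hfin.trans ?_
  have : 0 ≤ r ^ n := by positivity
  have h5 : 0 ≤ c * D := mul_nonneg hc0 hD0
  nlinarith [mul_nonneg h5 this]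

/-- A reversible kernel `κ` dominating a multiple of a reversible kernel `η` which satisfies a
geometric drift condition, with the sublevel sets of the drift function small for `η`, converges
geometrically in total variation from almost every starting point. -/
theorem ae_exists_geometric_bound_of_drift {η : Kernel X X} [IsMarkovKernel η]
    (hκ : κ.IsReversible π) (hη : η.IsReversible π) {c : ℝ} (hc : 0 < c) (hc1 : c ≤ 1)
    (hle : ∀ x, ENNReal.ofReal c • η x ≤ κ x) {V : X → ℝ} (hV : Measurable V)
    (hV1 : ∀ x, 1 ≤ V x) (hVi : ∀ x, Integrable V (η x)) {l K : ℝ} (hl0 : 0 ≤ l) (hl1 : l < 1)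
    (hK : 0 < K) (hdrift : ∀ x, ∫ y, V y ∂η x ≤ l * V x + K)
    (hmin : ∀ R : ℝ, ∃ β : ℝ, 0 < β ∧
      ∀ x, V x ≤ R → ENNReal.ofReal β • π.restrict {x | V x ≤ R} ≤ η x) :
    ∃ ρ : ℝ, 0 < ρ ∧ ρ < 1 ∧ ∀ᵐ x ∂π, ∃ c : ℝ, ∀ (n : ℕ) (f : X → ℝ), Measurable f →
      (∀ y, |f y| ≤ 1) → |∫ y, f y ∂(κ ^ n) x - ∫ y, f y ∂π| ≤ c * ρ ^ n := by
  obtain ⟨R0, hR0⟩ : ∃ R0 : ℕ, π {x | V x ≤ R0} ≠ 0 := by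
    by_contra! h
    have h1 : π (⋃ n : ℕ, {x | V x ≤ n}) = 0 := measure_iUnion_null h
    have h2 : (⋃ n : ℕ, {x | V x ≤ n}) = Set.univ := by
      ext x
      simpa using exists_nat_ge (V x)
    rw [h2, measure_univ] at h1
    exact one_ne_zero h1
  -- The first entry gives `C` positive mass; the second ensures `K < (1 - l) V / 2` off `C`.
  set R : ℝ := max R0 (2 * K / (1 - l)) with hR
  obtain ⟨β, hβ, hβm⟩ := hmin R
  set C : Set X := {x | V x ≤ R} with hCdef
  have hC : MeasurableSet C := measurableSet_le hV measurable_const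
  have hC0 : π C ≠ 0 := fun h => hR0 (measure_mono_null
    (fun x (hx : V x ≤ R0) => show V x ≤ R from hx.trans (le_max_left _ _)) h)
  have hq : 0 < π.real C := ENNReal.toReal_pos hC0 (measure_ne_top _ _)
  -- The drift function is shifted to `V + b`. The size of `b` makes `β` times the integral of `V +
  -- b` over `C` at least `2 K`, enough to pay for `K` on `C`.
  set b : ℝ := 2 * K / (β * π.real C) with hb
  have hb0 : 0 < b := by positivity
  have hbq : β * (b * π.real C) = 2 * K := by rw [hb]; field_simp
  -- The loss `θ b` must fit into the spare `K` on `C`, and `θ (V + b) ≤ θ (1 + b) V` into the spare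
  -- `(1 - l) V / 2` off `C`.
  set θ : ℝ := min (K / b) ((1 - l) / (2 * (1 + b))) with hθ
  have hl' : 0 < 1 - l := by linarith
  have hθ0 : 0 < θ := lt_min (by positivity) (by positivity)
  have hθ1 : θ * b ≤ K := (le_div_iff₀ hb0).1 (min_le_left _ _)
  have hθ2 : θ * (2 * (1 + b)) ≤ 1 - l := (le_div_iff₀ (by positivity)).1 (min_le_right _ _)
  have hθl : θ ≤ (1 - l) / 2 := by nlinarith [mul_pos hθ0 hb0]
  have hWi : ∀ x, Integrable (fun x => V x + b) (η x) := fun x => (hVi x).add (integrable_const b)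
  have hform : ∀ f, BddMeas.ip π f (BddMeas.op η f)
      ≤ (1 - θ) * BddMeas.ip π f f + β * BddMeas.ip π (BddMeas.ind hC) f ^ 2 := by
    refine ip_op_le_of_drift hη hC hβ.le (fun x hx => hβm x hx) (W := fun x => V x + b)
      (by fun_prop) (fun x => by linarith [hV1 x]) (w := R + b)
      (fun x hx => by linarith [show V x ≤ R from hx]) hWi (fun x => ?_)
    have h1 : ∫ y, V y + b ∂η x ≤ l * V x + K + b := by
      rw [integral_add (hVi x) (integrable_const b)]
      simpa using hdrift x
    refine h1.trans ?_
    by_cases hx : x ∈ C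
    · rw [Set.indicator_of_mem hx]
      have h2 : 2 * K ≤ β * ∫ y in C, V y + b ∂π := by
        rw [← hbq]
        refine mul_le_mul_of_nonneg_left ?_ hβ.le
        have h3 : Integrable (fun y => V y + b) (π.restrict C) := by
          refine Integrable.of_bound (by fun_prop) (R + b) ?_
          filter_upwards [ae_restrict_mem hC] with y hy
          rw [Real.norm_of_nonneg (by linarith [hV1 y])]
          linarith [show V y ≤ R from hy]
        have h4 := integral_mono (integrable_const b) h3 (fun y => by
          change b ≤ V y + b
          linarith [hV1 y])
        simpa [mul_comm] using h4
      nlinarith [hV1 x]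
    · rw [Set.indicator_of_notMem hx]
      have h2 : 2 * K / (1 - l) < V x :=
        (le_max_right _ _).trans_lt (not_le.1 (show ¬ V x ≤ R from hx))
      rw [div_lt_iff₀ hl'] at h2
      nlinarith [hV1 x]
  have hθ3 : θ < 1 := by linarith
  have hcθ : 0 < c * θ := mul_pos hc hθ0
  have hcθ1 : c * θ < 1 := by nlinarith
  refine ⟨1 - c * θ / 2, by linarith, by linarith, ?_⟩
  refine ae_exists_geometric_bound hκ hC hC0 (mul_pos hc hβ).le (fun x hx => ?_)
    (r := 1 - c * θ) (by linarith) (by linarith) (by linarith) (fun f => ?_)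
  · refine le_trans ?_ (hle x)
    rw [ENNReal.ofReal_mul hc.le, mul_smul]
    refine Measure.le_iff.2 fun s _ => ?_
    rw [Measure.smul_apply, Measure.smul_apply _ (η x)]
    exact mul_le_mul_right (hβm x hx s) _
  -- The comparison reads `⟨f, κ f⟩ ≤ (1 - c) ⟨f, f⟩ + c ⟨f, η f⟩`, so the gap `θ` of `η` becomes a
  -- gap `c θ` and the rank-one weight becomes `c β`.
  · have h1 := dirichlet_le hκ hη hc.le hle f
    have h2 := mul_le_mul_of_nonneg_left (hform f) hc.le
    nlinarith

end GeometricBound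

end HMC

noncomputable section

namespace HMC

variable {d : ℕ}

/-! ### Lebesgue density of the Gaussian momentum -/

theorem integrable_exp_neg_sq_norm :
    Integrable (fun p : E d => Real.exp (-‖p‖ ^ 2 / 2)) := by
  have := (GaussianFourier.integrable_cexp_neg_mul_sq_norm_add (V := E d) (b := 1 / 2)
    (by norm_num) 0 0).norm
  refine this.congr (ae_of_all _ fun p => ?_)
  simp only [zero_mul, add_zero, Complex.norm_exp]
  rw [show -(1 / 2 : ℂ) * (‖p‖ : ℂ) ^ 2 = ((-‖p‖ ^ 2 / 2 : ℝ) : ℂ) by push_cast; ring,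
    Complex.ofReal_re]

/-- The standard Gaussian has Lebesgue density proportional to `exp (-‖p‖² / 2)`. -/
theorem stdGaussian_eq_tilted :
    stdGaussian (E d) = (volume : Measure (E d)).tilted (fun p => -‖p‖ ^ 2 / 2) := by
  have := isProbabilityMeasure_tilted (μ := (volume : Measure (E d))) integrable_exp_neg_sq_norm
  refine Measure.ext_of_charFun ?_
  ext t
  rw [charFun_stdGaussian, charFun_apply, integral_tilted]
  have h0 := GaussianFourier.integral_cexp_neg_mul_sq_norm_add (V := E d) (b := 1 / 2)
    (by norm_num) 0 0
  have h1 := GaussianFourier.integral_cexp_neg_mul_sq_norm_add (V := E d) (b := 1 / 2)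
    (by norm_num) Complex.I t
  set A := ∫ p : E d, Real.exp (-‖p‖ ^ 2 / 2) with hA
  have hA0 : 0 < A := integral_exp_pos integrable_exp_neg_sq_norm
  have hAc : (A : ℂ) = ((Real.pi : ℂ) / (1 / 2)) ^ ((Module.finrank ℝ (E d) : ℂ) / 2) := by
    simp only [zero_mul, add_zero, norm_zero] at h0
    rw [hA, ← integral_complex_ofReal]
    simp only [Complex.ofReal_exp]
    rw [show (∫ p : E d, Complex.exp ((-‖p‖ ^ 2 / 2 : ℝ) : ℂ))
      = ∫ p : E d, Complex.exp (-(1 / 2) * (‖p‖ : ℂ) ^ 2) from ?_, h0]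
    · simp
    · congr 1 with p
      congr 1
      push_cast
      ring
  rw [← hAc] at h1
  have h2 : ∀ p : E d, (Real.exp (-‖p‖ ^ 2 / 2) / A) • Complex.exp (inner ℝ p t * Complex.I)
      = (A : ℂ)⁻¹ * Complex.exp (-(1 / 2) * (‖p‖ : ℂ) ^ 2 + Complex.I * inner ℝ t p) := by
    intro p
    rw [Complex.real_smul, Complex.exp_add, Complex.ofReal_div, Complex.ofReal_exp,
      real_inner_comm, mul_comm Complex.I]
    push_cast
    rw [show -(‖p‖ : ℂ) ^ 2 / 2 = -(1 / 2) * (‖p‖ : ℂ) ^ 2 by ring]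
    ring
  simp_rw [h2]
  rw [integral_const_mul, h1, ← mul_assoc, inv_mul_cancel₀ (by exact_mod_cast hA0.ne'), one_mul]
  congr 1
  rw [Complex.I_sq]
  ring

/-! ### Reversibility of the HMC kernel -/

/-- Reversal of the momentum. -/
def flip (z : E d × E d) : E d × E d := (z.1, -z.2)

/-- Leapfrog steps followed by momentum reversal. -/
def leapfrogFlip (U : E d → ℝ) (ε : ℝ) (L : ℕ) (z : E d × E d) : E d × E d :=
  flip (leapfrog U ε L z)

theorem flip_flip (z : E d × E d) : flip (flip z) = z := by simp [flip]

theorem hamiltonian_flip (U : E d → ℝ) (z : E d × E d) :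
    hamiltonian U (flip z) = hamiltonian U z := by simp [flip, hamiltonian]

/-- The scheme is palindromic: with the momentum reversed, the half kicks and the position update
are undone in mirrored order. The position is recovered first, because the last half kick uses the
gradient there. -/
theorem leapfrogStep_flip_leapfrogStep (U : E d → ℝ) (ε : ℝ) (z : E d × E d) :
    leapfrogStep U ε (flip (leapfrogStep U ε z)) = flip z := by
  have h : (leapfrogStep U ε z).1 + ε • (-(leapfrogStep U ε z).2
      - (ε / 2) • gradient U (leapfrogStep U ε z).1) = z.1 := by
    simp only [leapfrogStep]
    module
  have h2 : (leapfrogStep U ε (flip (leapfrogStep U ε z))).1 = z.1 := h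
  refine Prod.ext h2 ?_
  have h3 : (leapfrogStep U ε (flip (leapfrogStep U ε z))).2 =
      (-(leapfrogStep U ε z).2 - (ε / 2) • gradient U (leapfrogStep U ε z).1)
        - (ε / 2) • gradient U (leapfrogStep U ε (flip (leapfrogStep U ε z))).1 := rfl
  rw [h3, h2]
  simp only [leapfrogStep, flip]
  module

theorem leapfrogFlip_involutive (U : E d → ℝ) (ε : ℝ) (L : ℕ) :
    Function.Involutive (leapfrogFlip U ε L) := by
  have key : ∀ z : E d × E d, leapfrog U ε L (flip (leapfrog U ε L z)) = flip z := by
    unfold leapfrog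
    induction L with
    | zero => intro z; rfl
    | succ L ih =>
      intro z
      rw [Function.iterate_succ_apply' _ L z, Function.iterate_succ_apply,
        leapfrogStep_flip_leapfrogStep, ih]
  intro z
  simp only [leapfrogFlip]
  rw [key, flip_flip]

theorem measurePreserving_flip :
    MeasurePreserving (flip : E d × E d → E d × E d) :=
  (MeasurePreserving.id _).prod (Measure.measurePreserving_neg volume)

/-- Each substep is a shear, translating one variable by a function of the other. No Jacobian
enters, so a continuous gradient suffices. -/
theorem measurePreserving_leapfrogStep {U : E d → ℝ} (hU : ContDiff ℝ 1 U) (ε : ℝ) :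
    MeasurePreserving (leapfrogStep U ε) := by
  have hg := continuous_gradient hU
  have kick : MeasurePreserving (fun z : E d × E d => (z.1, z.2 - (ε / 2) • gradient U z.1)) :=
    (MeasurePreserving.id (volume : Measure (E d))).skew_product
      (g := fun x p => p - (ε / 2) • gradient U x) (by fun_prop)
      (ae_of_all _ fun x => (measurePreserving_sub_right volume _).map_eq)
  have drift' : MeasurePreserving (fun z : E d × E d => (z.1, z.2 + ε • z.1)) :=
    (MeasurePreserving.id (volume : Measure (E d))).skew_product
      (g := fun p x => x + ε • p) (by fun_prop)
      (ae_of_all _ fun x => (measurePreserving_add_right volume _).map_eq)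
  have swap : MeasurePreserving (Prod.swap : E d × E d → E d × E d) :=
    Measure.measurePreserving_swap
  exact kick.comp (swap.comp (drift'.comp (swap.comp kick)))

theorem measurePreserving_leapfrogFlip {U : E d → ℝ} (hU : ContDiff ℝ 1 U) (ε : ℝ) (L : ℕ) :
    MeasurePreserving (leapfrogFlip U ε L) :=
  measurePreserving_flip.comp ((measurePreserving_leapfrogStep hU ε).iterate L)

theorem acceptProb_nonneg (U : E d → ℝ) (ε : ℝ) (L : ℕ) (x p : E d) :
    0 ≤ acceptProb U ε L x p := le_min zero_le_one (Real.exp_pos _).le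

theorem acceptProb_le_one (U : E d → ℝ) (ε : ℝ) (L : ℕ) (x p : E d) :
    acceptProb U ε L x p ≤ 1 := min_le_left _ _

theorem continuous_hamiltonian {U : E d → ℝ} (hU : ContDiff ℝ 1 U) :
    Continuous (hamiltonian U) := by
  have hc := hU.continuous
  unfold hamiltonian
  fun_prop

theorem continuous_acceptProb {U : E d → ℝ} (hU : ContDiff ℝ 1 U) (ε : ℝ) (L : ℕ) :
    Continuous (fun z : E d × E d => acceptProb U ε L z.1 z.2) := by
  have hl := continuous_leapfrog hU ε L
  have hc := continuous_hamiltonian hU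
  unfold acceptProb
  fun_prop

theorem continuous_pos {U : E d → ℝ} (hU : ContDiff ℝ 1 U) (ε : ℝ) (L : ℕ) :
    Continuous (fun z : E d × E d => pos U ε L z.1 z.2) :=
  (continuous_leapfrog hU ε L).fst

theorem lintegral_uniform_ite {a : ℝ} (ha0 : 0 ≤ a) (ha1 : a ≤ 1) (b c : ℝ≥0∞) :
    ∫⁻ u in Set.Icc (0 : ℝ) 1, (if u < a then b else c)
      = ENNReal.ofReal a * b + ENNReal.ofReal (1 - a) * c := by
  have h1 : ∀ u : ℝ, (if u < a then b else c)
      = (Set.Iio a).indicator (fun _ => b) u + (Set.Ici a).indicator (fun _ => c) u := by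
    intro u
    by_cases h : u < a
    · simp [h]
    · simp [h, not_lt.1 h]
  simp_rw [h1]
  rw [lintegral_add_left (measurable_const.indicator measurableSet_Iio),
    lintegral_indicator_const measurableSet_Iio, lintegral_indicator_const measurableSet_Ici,
    Measure.restrict_apply measurableSet_Iio, Measure.restrict_apply measurableSet_Ici]
  have e1 : Set.Iio a ∩ Set.Icc (0 : ℝ) 1 = Set.Ico 0 a := by
    ext u
    simp only [Set.mem_inter_iff, Set.mem_Iio, Set.mem_Icc, Set.mem_Ico]
    constructor <;> intro h <;> constructor <;> try constructor
    all_goals linarith [h.1, h.2]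
  have e2 : Set.Ici a ∩ Set.Icc (0 : ℝ) 1 = Set.Icc a 1 := by
    ext u
    simp only [Set.mem_inter_iff, Set.mem_Ici, Set.mem_Icc]
    constructor <;> intro h <;> constructor <;> try constructor
    all_goals linarith [h.1, h.2]
  rw [e1, e2, Real.volume_Ico, Real.volume_Icc, sub_zero, mul_comm, mul_comm c]

theorem hmcKernel_apply_eq_tsum {U : E d → ℝ} (hU : ContDiff ℝ 1 U) (ε : ℝ) (𝔏 : PMF ℕ)
    (x : E d) {s : Set (E d)} (hs : MeasurableSet s) :
    hmcKernel hU ε 𝔏 x s = ∑' L, 𝔏 L * hmcKernel hU ε (PMF.pure L) x s := by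
  have hm : Measurable (hmcStep U ε x) := (measurable_hmcStep hU ε).comp measurable_prodMk_left
  have : ∀ 𝔏' : PMF ℕ, hmcKernel hU ε 𝔏' x s
      = ∫⁻ L, ((stdGaussian (E d)).prod ((volume : Measure ℝ).restrict (Set.Icc 0 1)))
          (Prod.mk L ⁻¹' (hmcStep U ε x ⁻¹' s)) ∂𝔏'.toMeasure := by
    intro 𝔏'
    have h1 : hmcKernel hU ε 𝔏' x s = (noiseLaw d 𝔏').map (hmcStep U ε x) s := rfl
    rw [h1, Measure.map_apply hm hs, noiseLaw, Measure.prod_apply (hm hs)]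
  simp_rw [this, PMF.toMeasure_pure, lintegral_dirac]
  rw [lintegral_countable']
  simp_rw [PMF.toMeasure_apply_singleton _ _ (measurableSet_singleton _), mul_comm]

theorem lintegral_hmcKernel_pure {U : E d → ℝ} (hU : ContDiff ℝ 1 U) (ε : ℝ) (L : ℕ)
    (x : E d) {g : E d → ℝ≥0∞} (hg : Measurable g) :
    ∫⁻ y, g y ∂hmcKernel hU ε (PMF.pure L) x
      = ∫⁻ p, ENNReal.ofReal (acceptProb U ε L x p) * g (pos U ε L x p)
          + ENNReal.ofReal (1 - acceptProb U ε L x p) * g x ∂stdGaussian (E d) := by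
  have hm : Measurable (hmcStep U ε x) := (measurable_hmcStep hU ε).comp measurable_prodMk_left
  have h1 : hmcKernel hU ε (PMF.pure L) x = (noiseLaw d (PMF.pure L)).map (hmcStep U ε x) := rfl
  have hgm : Measurable (fun a => g (hmcStep U ε x a)) := hg.comp hm
  have hgm' : Measurable (fun a => g (hmcStep U ε x (L, a))) := hgm.comp measurable_prodMk_left
  rw [h1, lintegral_map hg hm, noiseLaw, lintegral_prod _ hgm.aemeasurable,
    PMF.toMeasure_pure, lintegral_dirac, lintegral_prod _ hgm'.aemeasurable]
  congr 1 with p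
  rw [← lintegral_uniform_ite (acceptProb_nonneg U ε L x p) (acceptProb_le_one U ε L x p)]
  congr 1 with u
  simp only [hmcStep]
  split_ifs <;> rfl

/-- The unnormalized density of accepted moves on phase space. -/
def acceptDensity (U : E d → ℝ) (ε : ℝ) (L : ℕ) (z : E d × E d) : ℝ :=
  min (Real.exp (-hamiltonian U z)) (Real.exp (-hamiltonian U (leapfrogFlip U ε L z)))

/-- Detailed balance on phase space: the involution merely exchanges the arguments of the minimum.
-/
theorem acceptDensity_leapfrogFlip (U : E d → ℝ) (ε : ℝ) (L : ℕ) (z : E d × E d) :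
    acceptDensity U ε L (leapfrogFlip U ε L z) = acceptDensity U ε L z := by
  rw [acceptDensity, leapfrogFlip_involutive, min_comm, acceptDensity]

/-- The normalizing constant of the joint density `exp (-H)`. -/
def normConst (U : E d → ℝ) : ℝ :=
  ((∫ x, Real.exp (-U x)) * ∫ p : E d, Real.exp (-‖p‖ ^ 2 / 2))⁻¹

theorem normConst_nonneg (U : E d → ℝ) : 0 ≤ normConst U :=
  inv_nonneg.2 (mul_nonneg (integral_nonneg fun _ => (Real.exp_pos _).le)
    (integral_nonneg fun _ => (Real.exp_pos _).le))

theorem lintegral_target_stdGaussian {U : E d → ℝ} (hU : ContDiff ℝ 1 U)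
    {g : E d × E d → ℝ≥0∞} (hg : Measurable g) :
    ∫⁻ x, ∫⁻ p, g (x, p) ∂stdGaussian (E d) ∂target U
      = ∫⁻ z, ENNReal.ofReal (normConst U * Real.exp (-hamiltonian U z)) * g z := by
  have hc := hU.continuous
  have hH := continuous_hamiltonian hU
  have hgi : Measurable fun z : E d × E d =>
      ENNReal.ofReal (normConst U * Real.exp (-hamiltonian U z)) * g z := by fun_prop
  rw [target, stdGaussian_eq_tilted, lintegral_tilted, Measure.volume_eq_prod,
    lintegral_prod _ hgi.aemeasurable]
  congr 1 with x
  rw [lintegral_tilted, ← lintegral_const_mul _ (by fun_prop)]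
  congr 1 with p
  rw [← mul_assoc, ← ENNReal.ofReal_mul (div_nonneg (Real.exp_pos _).le
    (integral_nonneg fun _ => (Real.exp_pos _).le))]
  congr 2
  rw [normConst, hamiltonian, neg_add, Real.exp_add, neg_div]
  field_simp

theorem ofReal_mul_acceptProb (U : E d → ℝ) (ε : ℝ) (L : ℕ) (z : E d × E d) :
    ENNReal.ofReal (normConst U * Real.exp (-hamiltonian U z))
        * ENNReal.ofReal (acceptProb U ε L z.1 z.2)
      = ENNReal.ofReal (normConst U * acceptDensity U ε L z) := by
  rw [← ENNReal.ofReal_mul (mul_nonneg (normConst_nonneg U) (Real.exp_pos _).le), mul_assoc]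
  congr 2
  rw [acceptProb, acceptDensity, leapfrogFlip, hamiltonian_flip,
    mul_min_of_nonneg _ _ (Real.exp_pos _).le, mul_one, ← Real.exp_add]
  congr 2
  ring

/-- The flow from `A` to `B` splits into accepted and rejected moves. The change of variables by the
involution exchanges the two endpoints and preserves the accepted density; the momentum flip is
invisible because only positions are recorded. Rejections charge only `A ∩ B`, which is symmetric.
-/
theorem hmcKernel_pure_isReversible {U : E d → ℝ} (hU : ContDiff ℝ 1 U) (ε : ℝ) (L : ℕ) :
    (hmcKernel hU ε (PMF.pure L)).IsReversible (target U) := by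
  have hαm := (continuous_acceptProb hU ε L).measurable
  have hpm := (continuous_pos hU ε L).measurable
  have hΨ := measurePreserving_leapfrogFlip hU ε L
  let a : E d → E d → ℝ≥0∞ := fun x p => ENNReal.ofReal (acceptProb U ε L x p)
  let r : E d → E d → ℝ≥0∞ := fun x p => ENNReal.ofReal (1 - acceptProb U ε L x p)
  have ham : Measurable fun z : E d × E d => a z.1 z.2 := hαm.ennreal_ofReal
  let ind : Set (E d) → E d → ℝ≥0∞ := fun A => A.indicator 1
  have hind : ∀ {A}, MeasurableSet A → Measurable (ind A) := fun hA => measurable_one.indicator hA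
  let w : E d × E d → ℝ≥0∞ := fun z => ENNReal.ofReal (normConst U * acceptDensity U ε L z)
  have key : ∀ A B, MeasurableSet A → MeasurableSet B →
      ∫⁻ x in A, hmcKernel hU ε (PMF.pure L) x B ∂target U
        = (∫⁻ z, w z * (ind A z.1 * ind B (leapfrogFlip U ε L z).1))
          + ∫⁻ x, ∫⁻ p, ind A x * ind B x * r x p ∂stdGaussian (E d) ∂target U := by
    intro A B hA hB
    have hA' := hind hA
    have hB' := hind hB
    have m1 : Measurable fun z : E d × E d => ind A z.1 * (a z.1 z.2 * ind B (pos U ε L z.1 z.2)) :=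
      (hA'.comp measurable_fst).mul (ham.mul (hB'.comp hpm))
    have e1 : ∀ x, A.indicator (fun x => hmcKernel hU ε (PMF.pure L) x B) x
        = (∫⁻ p, ind A x * (a x p * ind B (pos U ε L x p)) ∂stdGaussian (E d))
          + ∫⁻ p, ind A x * ind B x * r x p ∂stdGaussian (E d) := by
      intro x
      have e2 := lintegral_hmcKernel_pure hU ε L x hB'
      rw [show ∫⁻ y, ind B y ∂_ = _ from lintegral_indicator_one hB] at e2
      have m1x : Measurable fun p => ind A x * (a x p * ind B (pos U ε L x p)) :=
        m1.comp measurable_prodMk_left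
      rw [← lintegral_add_left m1x]
      by_cases hx : x ∈ A
      · rw [Set.indicator_of_mem hx, e2]
        congr 1 with p
        simp only [ind, Set.indicator_of_mem hx, a, r, Pi.one_apply]
        ring
      · simp [ind, Set.indicator_of_notMem hx]
    rw [← lintegral_indicator hA]
    simp_rw [e1]
    rw [lintegral_add_left m1.lintegral_prod_right', lintegral_target_stdGaussian hU m1]
    congr 2 with z
    have := ofReal_mul_acceptProb U ε L z
    have e3 : (leapfrogFlip U ε L z).1 = pos U ε L z.1 z.2 := rfl
    simp only [w, a, ← this, e3]
    ring
  intro A B hA hB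
  rw [key A B hA hB, key B A hB hA]
  congr 1
  · have hw : Measurable w := by
      have h1 := continuous_hamiltonian hU
      have h2 := hΨ.measurable
      simp only [w, acceptDensity]
      fun_prop
    have m3 : Measurable fun z => w z * (ind B z.1 * ind A (leapfrogFlip U ε L z).1) :=
      hw.mul (((hind hB).comp measurable_fst).mul ((hind hA).comp hΨ.measurable.fst))
    rw [← hΨ.lintegral_comp m3]
    congr 1 with z
    rw [leapfrogFlip_involutive U ε L z]
    simp only [w, acceptDensity_leapfrogFlip]
    ring
  · simp_rw [mul_comm (ind A _)]

/-- The HMC chain is reversible with respect to its target. -/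
theorem hmcKernel_isReversible {U : E d → ℝ} (hU : ContDiff ℝ 1 U) (ε : ℝ) (𝔏 : PMF ℕ) :
    (hmcKernel hU ε 𝔏).IsReversible (target U) := by
  have key : ∀ A B, MeasurableSet B → ∫⁻ x in A, hmcKernel hU ε 𝔏 x B ∂target U
      = ∑' L, 𝔏 L * ∫⁻ x in A, hmcKernel hU ε (PMF.pure L) x B ∂target U := by
    intro A B hB
    simp_rw [hmcKernel_apply_eq_tsum hU ε 𝔏 _ hB]
    rw [lintegral_tsum fun L => ((Kernel.measurable_coe _ hB).const_mul _).aemeasurable]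
    simp_rw [lintegral_const_mul _ (Kernel.measurable_coe _ hB)]
  intro A B hA hB
  rw [key A B hB, key B A hA]
  simp_rw [hmcKernel_pure_isReversible hU ε _ hA hB]

/-- The HMC kernel dominates the part that uses a fixed number of leapfrog steps. -/
theorem smul_hmcKernel_pure_le {U : E d → ℝ} (hU : ContDiff ℝ 1 U) (ε : ℝ) (𝔏 : PMF ℕ) (L : ℕ)
    (x : E d) : 𝔏 L • hmcKernel hU ε (PMF.pure L) x ≤ hmcKernel hU ε 𝔏 x := by
  refine Measure.le_iff.2 fun s hs => ?_
  rw [hmcKernel_apply_eq_tsum hU ε 𝔏 x hs, Measure.smul_apply, smul_eq_mul]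
  exact ENNReal.le_tsum (f := fun L => 𝔏 L * hmcKernel hU ε (PMF.pure L) x s) L

/-! ### Minorization of the one-step kernel on compact sets -/

theorem pos_one (U : E d → ℝ) (ε : ℝ) (x p : E d) :
    pos U ε 1 x p = meanPos U ε 1 x 0 + ε • p := by
  simp only [pos, leapfrog, Function.iterate_one, leapfrogStep, meanPos, drift]
  simp
  module

theorem continuous_meanPos_one {U : E d → ℝ} (hU : ContDiff ℝ 1 U) (ε : ℝ) :
    Continuous (fun x : E d => meanPos U ε 1 x 0) := by
  have hg := continuous_gradient hU
  simp only [meanPos, drift, Finset.Ico_self, Finset.sum_empty]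
  fun_prop

theorem lintegral_comp_add_smul (m : E d) {ε : ℝ} (hε : ε ≠ 0) {g : E d → ℝ≥0∞}
    (hg : Measurable g) :
    ∫⁻ p, g (m + ε • p) = ENNReal.ofReal |(ε ^ Module.finrank ℝ (E d))⁻¹| * ∫⁻ y, g y := by
  have h1 : ∫⁻ p, g (m + ε • p) = ∫⁻ q, g (m + q) ∂(Measure.map (ε • ·) (volume : Measure (E d))) :=
    (lintegral_map (hg.comp (measurable_const_add m)) (measurable_const_smul ε)).symm
  rw [h1, Measure.map_addHaar_smul _ hε, lintegral_smul_measure, lintegral_add_left_eq_self,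
    smul_eq_mul]

/-- One-step HMC with a single leapfrog step is minorized on every compact set. -/
theorem exists_minorization {U : E d → ℝ} (hU : ContDiff ℝ 1 U)
    (hint : Integrable (fun x => Real.exp (-U x)) volume) {ε : ℝ} (hε : 0 < ε) {C : Set (E d)}
    (hC : IsCompact C) :
    ∃ β : ℝ, 0 < β ∧ ∀ x ∈ C,
      ENNReal.ofReal β • (target U).restrict C ≤ hmcKernel hU ε (PMF.pure 1) x := by
  rcases C.eq_empty_or_nonempty with rfl | hne
  · exact ⟨1, one_pos, fun x hx => hx.elim⟩
  have hcU := hU.continuous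
  have hcm := continuous_meanPos_one hU ε
  have hca := continuous_acceptProb hU ε 1
  set Z₁ : ℝ := ∫ x, Real.exp (-U x) with hZ₁
  set Z₂ : ℝ := ∫ p : E d, Real.exp (-‖p‖ ^ 2 / 2) with hZ₂
  have hZ₁0 : 0 < Z₁ := integral_exp_pos hint
  have hZ₂0 : 0 < Z₂ := integral_exp_pos integrable_exp_neg_sq_norm
  -- The unique momentum carrying `x` to `y` in one step.
  let mom : E d → E d → E d := fun x y => ε⁻¹ • (y - meanPos U ε 1 x 0)
  let D : E d → E d → ℝ := fun x p =>
    Real.exp (-‖p‖ ^ 2 / 2) / Z₂ * acceptProb U ε 1 x p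
  -- Up to the Jacobian `c` below, the density of accepted moves relative to the target. It is
  -- continuous and strictly positive, so its minimum over `C × C` yields `β`.
  let G : E d × E d → ℝ := fun z => D z.1 (mom z.1 z.2) / (Real.exp (-U z.2) / Z₁)
  have hGc : Continuous G := by
    have hm : Continuous fun z : E d × E d => mom z.1 z.2 := by
      simp only [mom]
      fun_prop
    have h1 : Continuous fun z : E d × E d => acceptProb U ε 1 z.1 (mom z.1 z.2) :=
      hca.comp (continuous_fst.prodMk hm)
    simp only [G, D]
    refine Continuous.div (by fun_prop) (by fun_prop) fun z => ?_
    have := Real.exp_pos (-U z.2)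
    positivity
  have hG0 : ∀ z, 0 < G z := fun z => by
    have h1 : 0 < acceptProb U ε 1 z.1 (mom z.1 z.2) := lt_min one_pos (Real.exp_pos _)
    have := Real.exp_pos (-U z.2)
    simp only [G, D]
    positivity
  obtain ⟨z₀, -, hz₀⟩ := (hC.prod hC).exists_isMinOn (hne.prod hne) hGc.continuousOn
  set c : ℝ := |(ε ^ Module.finrank ℝ (E d))⁻¹| with hc
  have hc0 : 0 < c := by positivity
  refine ⟨G z₀ * c, mul_pos (hG0 z₀) hc0, fun x hx => Measure.le_iff.2 fun s hs => ?_⟩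
  have hCm := hC.measurableSet
  have hs1 : Measurable (s.indicator (1 : E d → ℝ≥0∞)) := measurable_one.indicator hs
  have hQ : Measurable ((s ∩ C).indicator
      fun y => ENNReal.ofReal (G z₀) * ENNReal.ofReal (Real.exp (-U y) / Z₁)) := by
    refine Measurable.indicator ?_ (hs.inter hCm)
    fun_prop
  rw [← lintegral_indicator_one (μ := hmcKernel hU ε (PMF.pure 1) x) hs, lintegral_hmcKernel_pure hU ε 1 x hs1,
    stdGaussian_eq_tilted, lintegral_tilted]
  calc (ENNReal.ofReal (G z₀ * c) • (target U).restrict C) s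
      = ENNReal.ofReal c * ∫⁻ y, (s ∩ C).indicator
          (fun y => ENNReal.ofReal (G z₀) * ENNReal.ofReal (Real.exp (-U y) / Z₁)) y := by
        rw [Measure.smul_apply, Measure.restrict_apply hs, target,
          tilted_apply' _ _ (hs.inter hCm), lintegral_indicator (hs.inter hCm),
          lintegral_const_mul _ (by fun_prop), smul_eq_mul, mul_comm (G z₀),
          ENNReal.ofReal_mul hc0.le, mul_assoc]
    _ = ∫⁻ p, (s ∩ C).indicator
          (fun y => ENNReal.ofReal (G z₀) * ENNReal.ofReal (Real.exp (-U y) / Z₁))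
          (meanPos U ε 1 x 0 + ε • p) := (lintegral_comp_add_smul _ hε.ne' hQ).symm
    _ ≤ _ := by
        refine lintegral_mono fun p => ?_
        rw [← pos_one]
        by_cases hy : pos U ε 1 x p ∈ s ∩ C
        · have hm : mom x (pos U ε 1 x p) = p := by
            simp only [mom, pos_one, add_sub_cancel_left]
            rw [smul_smul, inv_mul_cancel₀ hε.ne', one_smul]
          have h1 : G z₀ ≤ G (x, pos U ε 1 x p) := hz₀ ⟨hx, hy.2⟩
          have h2 : G z₀ * (Real.exp (-U (pos U ε 1 x p)) / Z₁) ≤ D x p := by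
            have h3 : 0 < Real.exp (-U (pos U ε 1 x p)) / Z₁ := div_pos (Real.exp_pos _) hZ₁0
            simp only [G, hm] at h1
            exact (le_div_iff₀ h3).1 h1
          rw [Set.indicator_of_mem hy, ← ENNReal.ofReal_mul (hG0 _).le,
            Set.indicator_of_mem hy.1, Pi.one_apply, mul_one]
          refine (ENNReal.ofReal_le_ofReal h2).trans ?_
          simp only [D]
          rw [ENNReal.ofReal_mul (by positivity)]
          gcongr
          exact le_self_add
        · rw [Set.indicator_of_notMem hy]
          exact zero_le

/-! ### Exponential drift of Gaussian proposals -/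

theorem exp_le_one_add_add_sq_mul_exp_abs (t : ℝ) :
    Real.exp t ≤ 1 + t + t ^ 2 * Real.exp |t| := by
  have h1 : 1 ≤ Real.exp |t| := Real.one_le_exp (abs_nonneg t)
  rcases le_or_gt |t| 1 with h | h
  · have h2 := (abs_le.1 (Real.abs_exp_sub_one_sub_id_le h)).2
    nlinarith [sq_nonneg t]
  · rcases lt_abs.1 h with h' | h'
    · rw [abs_of_pos (by linarith)]
      have h2 : 1 ≤ t ^ 2 := one_le_pow₀ h'.le
      linarith [mul_le_mul_of_nonneg_right h2 (Real.exp_pos t).le]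
    · have h2 : Real.exp t ≤ 1 := Real.exp_le_one_iff.2 (by linarith)
      nlinarith [sq_nonneg t]

theorem sq_le_mul_exp {t : ℝ} (ht : 0 ≤ t) : t ^ 2 ≤ 2 * Real.exp t := by
  have := Real.quadratic_le_exp_of_nonneg ht
  nlinarith

/-- Expansion to second order in `s` with an envelope independent of `s`. For `q = ‖p‖²` and small
fixed `σ` the envelope is Gaussian-integrable, so `s` can afterwards be taken small enough for the
linear term to dominate. -/
theorem exp_mul_le_of_abs_le {s σ t A B q : ℝ} (hs : 0 ≤ s) (hσ : 0 < σ) (hsσ : s ≤ σ)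
    (ht : |t| ≤ A + B * q) : Real.exp (s * t)
      ≤ 1 + s * t + s ^ 2 * (2 / σ ^ 2 * Real.exp (2 * σ * A) * Real.exp (2 * σ * B * q)) := by
  set g := A + B * q with hg
  have hg0 : 0 ≤ g := (abs_nonneg _).trans ht
  have h3 : t ^ 2 ≤ 2 / σ ^ 2 * Real.exp (σ * g) := by
    rw [div_mul_eq_mul_div, le_div_iff₀ (by positivity)]
    calc t ^ 2 * σ ^ 2 = (σ * |t|) ^ 2 := by rw [mul_pow, sq_abs, mul_comm]
      _ ≤ (σ * g) ^ 2 := pow_le_pow_left₀ (by positivity) (mul_le_mul_of_nonneg_left ht hσ.le) 2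
      _ ≤ _ := sq_le_mul_exp (mul_nonneg hσ.le hg0)
  have h6 : Real.exp |s * t| ≤ Real.exp (σ * g) := by
    rw [Real.exp_le_exp, abs_mul, abs_of_nonneg hs]
    exact mul_le_mul hsσ ht (abs_nonneg _) hσ.le
  have h2 : t ^ 2 * Real.exp |s * t|
      ≤ 2 / σ ^ 2 * Real.exp (2 * σ * A) * Real.exp (2 * σ * B * q) := by
    calc _ ≤ 2 / σ ^ 2 * Real.exp (σ * g) * Real.exp (σ * g) :=
          mul_le_mul h3 h6 (Real.exp_pos _).le (by positivity)
      _ = _ := by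
          rw [mul_assoc, mul_assoc, ← Real.exp_add, ← Real.exp_add, hg]
          congr 2
          ring
  calc _ ≤ 1 + s * t + (s * t) ^ 2 * Real.exp |s * t| := exp_le_one_add_add_sq_mul_exp_abs _
    _ = 1 + s * t + s ^ 2 * (t ^ 2 * Real.exp |s * t|) := by ring
    _ ≤ _ := by
        have := mul_le_mul_of_nonneg_left h2 (sq_nonneg s)
        linarith

theorem integrable_exp_mul_norm (t : ℝ) :
    Integrable (fun p : E d => Real.exp (t * ‖p‖)) (stdGaussian (E d)) := by
  obtain ⟨C, hC, hCi⟩ := IsGaussian.exists_integrable_exp_sq (stdGaussian (E d))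
  refine (hCi.const_mul (Real.exp (t ^ 2 / (4 * C)))).mono' (by fun_prop) (ae_of_all _ fun p => ?_)
  rw [Real.norm_of_nonneg (Real.exp_pos _).le, ← Real.exp_add, Real.exp_le_exp]
  have : t ^ 2 / (4 * C) + C * ‖p‖ ^ 2 - t * ‖p‖ = C * (‖p‖ - t / (2 * C)) ^ 2 := by
    field_simp
    ring
  have h2 : 0 ≤ C * (‖p‖ - t / (2 * C)) ^ 2 := by positivity
  linarith

theorem integrable_sq_norm : Integrable (fun p : E d => ‖p‖ ^ 2) (stdGaussian (E d)) := by
  refine ((integrable_exp_mul_norm (d := d) 1).const_mul 2).mono' (by fun_prop)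
    (ae_of_all _ fun p => ?_)
  rw [Real.norm_of_nonneg (by positivity), one_mul]
  exact sq_le_mul_exp (norm_nonneg p)

/-- Second-order expansion of the norm of a Gaussian perturbation. -/
theorem norm_add_smul_sub_norm_le {η ε : ℝ} (hη : 0 < η) {m x p : E d} (hx : 0 < ‖x‖)
    (hm : ‖m‖ ≤ ‖x‖ - η) :
    ‖m + ε • p‖ - ‖x‖
      ≤ -η / 2 + ε * inner ℝ (‖x‖⁻¹ • m) p + ε ^ 2 * ‖p‖ ^ 2 / (2 * ‖x‖) := by
  have h1 : ‖m + ε • p‖ ^ 2 = ‖m‖ ^ 2 + 2 * (ε * inner ℝ m p) + ε ^ 2 * ‖p‖ ^ 2 := by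
    rw [norm_add_sq_real, inner_smul_right, norm_smul, mul_pow, Real.norm_eq_abs, sq_abs]
  have h2 : -η / 2 + ε * inner ℝ (‖x‖⁻¹ • m) p + ε ^ 2 * ‖p‖ ^ 2 / (2 * ‖x‖)
      = (-(η * ‖x‖) + 2 * (ε * inner ℝ m p) + ε ^ 2 * ‖p‖ ^ 2) / (2 * ‖x‖) := by
    rw [real_inner_smul_left]
    field_simp
  -- This is `a - b ≤ (a² - b²) / (2 b)` together with `‖m‖² ≤ ‖x‖² - η ‖x‖`.
  rw [h2, le_div_iff₀ (by positivity)]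
  nlinarith [sq_nonneg (‖m + ε • p‖ - ‖x‖), norm_nonneg m, mul_nonneg (norm_nonneg m) hη.le,
    mul_nonneg (norm_nonneg m) (sub_nonneg.2 hm)]

/-- A Gaussian perturbation of a point that is closer to the origin by a fixed amount decreases
`exp (s ‖x‖)` on average. -/
theorem exists_gaussian_drift {η ε : ℝ} (hη : 0 < η) (hε : 0 < ε) :
    ∃ s l r : ℝ, 0 < s ∧ 0 < l ∧ l < 1 ∧ ∀ m x : E d, r ≤ ‖x‖ → ‖m‖ ≤ ‖x‖ - η →
      ∫ p, Real.exp (s * ‖m + ε • p‖) ∂stdGaussian (E d) ≤ l * Real.exp (s * ‖x‖) := by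
  obtain ⟨C, hC, hCi⟩ := IsGaussian.exists_integrable_exp_sq (stdGaussian (E d))
  set Q := ∫ p : E d, ‖p‖ ^ 2 ∂stdGaussian (E d) with hQ
  have hQ0 : 0 ≤ Q := integral_nonneg fun _ => by positivity
  set A : ℝ := η / 2 + ε with hA
  set B : ℝ := ε + ε ^ 2 with hB
  have hB0 : 0 < B := by positivity
  -- Matches the envelope exponent `2 σ B` to the Fernique exponent `C`.
  set σ : ℝ := C / (2 * B) with hσ
  have hσ0 : 0 < σ := by positivity
  have hσB : 2 * σ * B = C := by rw [hσ]; field_simp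
  set M : ℝ := 2 / σ ^ 2 * Real.exp (2 * σ * A) with hM
  have hM0 : 0 < M := by positivity
  set K : ℝ := M * ∫ p : E d, Real.exp (C * ‖p‖ ^ 2) ∂stdGaussian (E d) with hK
  have hK0 : 0 ≤ K := mul_nonneg hM0.le (integral_nonneg fun _ => (Real.exp_pos _).le)
  set s : ℝ := min σ (min (η / (8 * (K + 1))) (1 / η)) with hs
  have hs0 : 0 < s := lt_min hσ0 (lt_min (by positivity) (by positivity))
  have hsσ : s ≤ σ := min_le_left _ _
  have hsK : s * (8 * (K + 1)) ≤ η :=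
    (le_div_iff₀ (by positivity)).1 ((min_le_right _ _).trans (min_le_left _ _))
  have hsη : s * η ≤ 1 :=
    (le_div_iff₀ hη).1 ((min_le_right _ _).trans (min_le_right _ _))
  -- Budget for the linear gain `s η / 2`: the radius keeps the curvature term below `s η / 4`, and
  -- the choice of `s` keeps the remainder `s² K` below `s η / 8`, leaving `s η / 8`.
  refine ⟨s, 1 - s * η / 8, max 1 (2 * ε ^ 2 * Q / η), hs0, by linarith, by nlinarith,
    fun m x hx hm => ?_⟩
  have hx1 : 1 ≤ ‖x‖ := (le_max_left _ _).trans hx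
  have hx0 : 0 < ‖x‖ := by linarith
  have hxQ : 2 * ε ^ 2 * Q ≤ ‖x‖ * η := (div_le_iff₀ hη).1 ((le_max_right _ _).trans hx)
  set u : E d := ‖x‖⁻¹ • m with hu
  have hu1 : ‖u‖ ≤ 1 := by
    rw [hu, norm_smul, norm_inv, norm_norm, inv_mul_le_iff₀ hx0]
    linarith
  let T : E d → ℝ := fun p => -η / 2 + ε * inner ℝ u p + ε ^ 2 * ‖p‖ ^ 2 / (2 * ‖x‖)
  have hTabs : ∀ p, |T p| ≤ A + B * ‖p‖ ^ 2 := by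
    intro p
    have h1 : |inner ℝ u p| ≤ ‖p‖ := by
      refine (abs_real_inner_le_norm u p).trans ?_
      nlinarith [norm_nonneg p]
    have h2 : ε ^ 2 * ‖p‖ ^ 2 / (2 * ‖x‖) ≤ ε ^ 2 * ‖p‖ ^ 2 :=
      div_le_self (by positivity) (by linarith)
    have h3 : 0 ≤ ε ^ 2 * ‖p‖ ^ 2 / (2 * ‖x‖) := by positivity
    have h4 : ‖p‖ ≤ 1 + ‖p‖ ^ 2 := by nlinarith [sq_nonneg (‖p‖ - 1 / 2)]
    obtain ⟨h5, h6⟩ := abs_le.1 h1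
    have h7 : ε * inner ℝ u p ≤ ε * (1 + ‖p‖ ^ 2) :=
      mul_le_mul_of_nonneg_left (h6.trans h4) hε.le
    have h8 : -(ε * (1 + ‖p‖ ^ 2)) ≤ ε * inner ℝ u p := by
      rw [← mul_neg]
      exact mul_le_mul_of_nonneg_left (by linarith) hε.le
    have h9 : 0 ≤ ε ^ 2 * ‖p‖ ^ 2 := by positivity
    rw [abs_le]
    simp only [T, hA, hB]
    constructor <;> linarith
  have hbound : ∀ p, Real.exp (s * T p)
      ≤ 1 + s * T p + s ^ 2 * (M * Real.exp (C * ‖p‖ ^ 2)) := fun p => by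
    rw [← hσB]
    exact exp_mul_le_of_abs_le hs0.le hσ0 hsσ (hTabs p)
  have hinner : Integrable (fun p => inner ℝ u p) (stdGaussian (E d)) :=
    IsGaussian.integrable_id.const_inner u
  have hinner0 : ∫ p, inner ℝ u p ∂stdGaussian (E d) = 0 := by
    have := integral_inner (𝕜 := ℝ) (IsGaussian.integrable_id (μ := stdGaussian (E d))) u
    simp only [id] at this
    rw [this, integral_id_stdGaussian, inner_zero_right]
  have hTi : Integrable T (stdGaussian (E d)) :=
    ((integrable_const _).add (hinner.const_mul ε)).add
      ((integrable_sq_norm.const_mul _).div_const _)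
  have hTint : ∫ p, T p ∂stdGaussian (E d) = -η / 2 + ε ^ 2 * Q / (2 * ‖x‖) := by
    have i1 : Integrable (fun p => -η / 2 + ε * inner ℝ u p) (stdGaussian (E d)) :=
      (integrable_const _).add (hinner.const_mul ε)
    simp only [T]
    rw [integral_add i1 ((integrable_sq_norm.const_mul _).div_const _),
      integral_add (integrable_const _) (hinner.const_mul ε), integral_const_mul, hinner0,
      integral_div (2 * ‖x‖), integral_const_mul, ← hQ]
    simp
  have hRi : Integrable (fun p => 1 + s * T p + s ^ 2 * (M * Real.exp (C * ‖p‖ ^ 2)))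
      (stdGaussian (E d)) :=
    ((integrable_const _).add (hTi.const_mul s)).add ((hCi.const_mul M).const_mul _)
  have hRint : ∫ p, (1 + s * T p + s ^ 2 * (M * Real.exp (C * ‖p‖ ^ 2))) ∂stdGaussian (E d)
      = 1 + s * (-η / 2 + ε ^ 2 * Q / (2 * ‖x‖)) + s ^ 2 * K := by
    have i1 : Integrable (fun p => 1 + s * T p) (stdGaussian (E d)) :=
      (integrable_const _).add (hTi.const_mul s)
    rw [integral_add i1 ((hCi.const_mul M).const_mul _),
      integral_add (integrable_const _) (hTi.const_mul s), integral_const_mul, hTint,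
      integral_const_mul, integral_const_mul]
    simp [hK]
  have hle : ∀ p, Real.exp (s * ‖m + ε • p‖)
      ≤ Real.exp (s * ‖x‖) * (1 + s * T p + s ^ 2 * (M * Real.exp (C * ‖p‖ ^ 2))) := by
    intro p
    refine le_trans ?_ (mul_le_mul_of_nonneg_left (hbound p) (Real.exp_pos _).le)
    rw [← Real.exp_add, Real.exp_le_exp, ← mul_add]
    refine mul_le_mul_of_nonneg_left ?_ hs0.le
    have := norm_add_smul_sub_norm_le (ε := ε) (p := p) hη hx0 hm
    simp only [T]
    linarith
  refine (integral_mono_of_nonneg (ae_of_all _ fun p => (Real.exp_pos _).le)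
    (hRi.const_mul _) (ae_of_all _ hle)).trans ?_
  rw [integral_const_mul, hRint, mul_comm]
  refine mul_le_mul_of_nonneg_right ?_ (Real.exp_pos _).le
  have h1 : ε ^ 2 * Q / (2 * ‖x‖) ≤ η / 4 := by
    rw [div_le_iff₀ (by positivity)]
    linarith
  nlinarith [mul_le_mul_of_nonneg_left h1 hs0.le, mul_le_mul_of_nonneg_left hsK hs0.le]

/-! ### Drift of the one-step chain and geometric ergodicity -/

theorem integral_hmcKernel_pure {U : E d → ℝ} (hU : ContDiff ℝ 1 U) (ε : ℝ) (L : ℕ) (x : E d)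
    {V : E d → ℝ} (hV : Continuous V) (hV0 : ∀ y, 0 ≤ V y)
    (hi : Integrable (fun p => V (pos U ε L x p)) (stdGaussian (E d))) :
    Integrable V (hmcKernel hU ε (PMF.pure L) x) ∧
    Integrable (fun p => acceptProb U ε L x p * V (pos U ε L x p)
      + (1 - acceptProb U ε L x p) * V x) (stdGaussian (E d)) ∧
    ∫ y, V y ∂hmcKernel hU ε (PMF.pure L) x
      = ∫ p, (acceptProb U ε L x p * V (pos U ε L x p) + (1 - acceptProb U ε L x p) * V x)
          ∂stdGaussian (E d) := by
  have hα : Continuous fun p => acceptProb U ε L x p :=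
    (continuous_acceptProb hU ε L).comp (Continuous.prodMk_right x)
  have hp : Continuous fun p => pos U ε L x p :=
    (continuous_pos hU ε L).comp (Continuous.prodMk_right x)
  have h0 : ∀ p, 0 ≤ acceptProb U ε L x p * V (pos U ε L x p)
      + (1 - acceptProb U ε L x p) * V x := fun p =>
    add_nonneg (mul_nonneg (acceptProb_nonneg U ε L x p) (hV0 _))
      (mul_nonneg (sub_nonneg.2 (acceptProb_le_one U ε L x p)) (hV0 _))
  have hR : Integrable (fun p => acceptProb U ε L x p * V (pos U ε L x p)
      + (1 - acceptProb U ε L x p) * V x) (stdGaussian (E d)) := by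
    refine (hi.add (integrable_const (V x))).mono' (by fun_prop) (ae_of_all _ fun p => ?_)
    rw [Real.norm_of_nonneg (h0 p)]
    refine add_le_add (mul_le_of_le_one_left (hV0 _) (acceptProb_le_one U ε L x p))
      (mul_le_of_le_one_left (hV0 _) ?_)
    linarith [acceptProb_nonneg U ε L x p]
  have hl : ∫⁻ y, ENNReal.ofReal (V y) ∂hmcKernel hU ε (PMF.pure L) x
      = ENNReal.ofReal (∫ p, (acceptProb U ε L x p * V (pos U ε L x p)
          + (1 - acceptProb U ε L x p) * V x) ∂stdGaussian (E d)) := by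
    rw [lintegral_hmcKernel_pure hU ε L x hV.measurable.ennreal_ofReal,
      ofReal_integral_eq_lintegral_ofReal hR (ae_of_all _ h0)]
    congr 1 with p
    rw [ENNReal.ofReal_add (mul_nonneg (acceptProb_nonneg U ε L x p) (hV0 _))
        (mul_nonneg (sub_nonneg.2 (acceptProb_le_one U ε L x p)) (hV0 _)),
      ENNReal.ofReal_mul (acceptProb_nonneg U ε L x p),
      ENNReal.ofReal_mul (sub_nonneg.2 (acceptProb_le_one U ε L x p))]
  have hVi : Integrable V (hmcKernel hU ε (PMF.pure L) x) := by
    refine ⟨hV.aestronglyMeasurable, ?_⟩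
    rw [hasFiniteIntegral_iff_ofReal (ae_of_all _ hV0), hl]
    exact ENNReal.ofReal_lt_top
  refine ⟨hVi, hR, ?_⟩
  rw [integral_eq_lintegral_of_nonneg_ae (ae_of_all _ hV0) hV.aestronglyMeasurable, hl,
    ENNReal.toReal_ofReal (integral_nonneg h0)]

theorem eventually_farPos {p : E d → Prop} : (∀ᶠ x in farPos d, p x) ↔ ∃ R, ∀ x, R ≤ ‖x‖ → p x := by
  rw [farPos, eventually_comap, eventually_atTop]
  constructor
  · rintro ⟨R, h⟩
    exact ⟨R, fun x hx => h _ hx x rfl⟩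
  · rintro ⟨R, h⟩
    exact ⟨R, fun r hr x hx => h x (hx ▸ hr)⟩

theorem integrable_exp_norm_pos_one (U : E d → ℝ) (ε : ℝ) {s : ℝ} (hs : 0 ≤ s) (x : E d) :
    Integrable (fun p => Real.exp (s * ‖pos U ε 1 x p‖)) (stdGaussian (E d)) ∧
    ∫ p, Real.exp (s * ‖pos U ε 1 x p‖) ∂stdGaussian (E d)
      ≤ Real.exp (s * ‖meanPos U ε 1 x 0‖)
        * ∫ p : E d, Real.exp (s * |ε| * ‖p‖) ∂stdGaussian (E d) := by
  have hle : ∀ p, Real.exp (s * ‖pos U ε 1 x p‖)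
      ≤ Real.exp (s * ‖meanPos U ε 1 x 0‖) * Real.exp (s * |ε| * ‖p‖) := by
    intro p
    rw [← Real.exp_add, Real.exp_le_exp, pos_one, mul_assoc, ← mul_add]
    refine mul_le_mul_of_nonneg_left ((norm_add_le _ _).trans_eq ?_) hs
    rw [norm_smul, Real.norm_eq_abs]
  have hi := (integrable_exp_mul_norm (d := d) (s * |ε|)).const_mul
    (Real.exp (s * ‖meanPos U ε 1 x 0‖))
  have hi' : Integrable (fun p => Real.exp (s * ‖pos U ε 1 x p‖)) (stdGaussian (E d)) := by
    refine hi.mono' ?_ (ae_of_all _ fun p => ?_)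
    · simp only [pos_one]
      fun_prop
    · rw [Real.norm_of_nonneg (Real.exp_pos _).le]
      exact hle p
  refine ⟨hi', (integral_mono hi' hi hle).trans_eq ?_⟩
  rw [integral_const_mul]

/-- Geometric drift of the chain with a single leapfrog step. -/
theorem exists_drift {U : E d → ℝ} (hU : ContDiff ℝ 1 U) {ε : ℝ} (hε : 0 < ε)
    (hin : InwardsAcceptance U ε 1) {η R : ℝ} (hη : 0 < η)
    (hm : ∀ x, R ≤ ‖x‖ → ‖meanPos U ε 1 x 0‖ ≤ ‖x‖ - η) :
    ∃ s l K : ℝ, 0 < s ∧ 0 ≤ l ∧ l < 1 ∧ 0 < K ∧ ∀ x,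
      Integrable (fun y => Real.exp (s * ‖y‖)) (hmcKernel hU ε (PMF.pure 1) x) ∧
      ∫ y, Real.exp (s * ‖y‖) ∂hmcKernel hU ε (PMF.pure 1) x
        ≤ l * Real.exp (s * ‖x‖) + K := by
  obtain ⟨s, l, r, hs, hl0, hl1, hdrift⟩ := exists_gaussian_drift (d := d) hη hε
  -- Half of the gap `1 - l` is spent on rejected inward moves, giving the final rate `(1 + l) / 2`.
  obtain ⟨R', hR'⟩ := eventually_farPos.1 (hin.eventually_le_const
    (u := ENNReal.ofReal ((1 - l) / 2)) (ENNReal.ofReal_pos.2 (by linarith)))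
  set R₀ := max (max R r) R' with hR₀
  obtain ⟨M, hM⟩ := (isCompact_closedBall (0 : E d) R₀).exists_bound_of_continuousOn
    (continuous_meanPos_one hU ε).continuousOn
  set I := ∫ p : E d, Real.exp (s * |ε| * ‖p‖) ∂stdGaussian (E d) with hI
  have hI0 : 0 ≤ I := integral_nonneg fun _ => (Real.exp_pos _).le
  have hV : Continuous fun y : E d => Real.exp (s * ‖y‖) := by fun_prop
  refine ⟨s, (1 + l) / 2, Real.exp (s * M) * I + Real.exp (s * R₀), hs, by linarith, by linarith,
    add_pos_of_nonneg_of_pos (mul_nonneg (Real.exp_pos _).le hI0) (Real.exp_pos _), fun x => ?_⟩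
  obtain ⟨hi, hile⟩ := integrable_exp_norm_pos_one U ε hs.le x
  obtain ⟨h1, h2, h3⟩ := integral_hmcKernel_pure hU ε 1 x hV (fun y => (Real.exp_pos _).le) hi
  refine ⟨h1, ?_⟩
  rw [h3]
  have hα0 := acceptProb_nonneg U ε 1 x
  have hα1 := acceptProb_le_one U ε 1 x
  rcases le_or_gt R₀ ‖x‖ with hx | hx
  · have hxR : R ≤ ‖x‖ := (le_max_left _ _).trans ((le_max_left _ _).trans hx)
    have hxr : r ≤ ‖x‖ := (le_max_right _ _).trans ((le_max_left _ _).trans hx)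
    have hS := hR' x ((le_max_right _ _).trans hx)
    set S : Set (E d) := {p | acceptProb U ε 1 x p < 1 ∧ ‖pos U ε 1 x p‖ ≤ ‖x‖} with hSdef
    have hSm : MeasurableSet S := by
      refine MeasurableSet.inter (s₁ := {p | acceptProb U ε 1 x p < 1})
        (s₂ := {p | ‖pos U ε 1 x p‖ ≤ ‖x‖}) (measurableSet_lt ?_ measurable_const)
        (measurableSet_le ?_ measurable_const)
      · exact (continuous_acceptProb hU ε 1).measurable.comp measurable_prodMk_left
      · exact ((continuous_pos hU ε 1).measurable.comp measurable_prodMk_left).norm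
    -- Outside `S` either acceptance is certain or the candidate lies farther out than `x`; in the
    -- latter case staying costs no more than moving. Rejection hurts only on `S`.
    have hle : ∀ p, acceptProb U ε 1 x p * Real.exp (s * ‖pos U ε 1 x p‖)
          + (1 - acceptProb U ε 1 x p) * Real.exp (s * ‖x‖)
        ≤ Real.exp (s * ‖pos U ε 1 x p‖) + S.indicator (fun _ => Real.exp (s * ‖x‖)) p := by
      intro p
      have e1 := Real.exp_pos (s * ‖pos U ε 1 x p‖)
      have e2 := Real.exp_pos (s * ‖x‖)
      by_cases hp : p ∈ S
      · rw [Set.indicator_of_mem hp]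
        nlinarith [hα0 p, hα1 p]
      · rw [Set.indicator_of_notMem hp]
        rcases (hα1 p).lt_or_eq with h | h
        · have h4 : ‖x‖ ≤ ‖pos U ε 1 x p‖ := by
            by_contra h5
            exact hp ⟨h, (not_le.1 h5).le⟩
          have h6 : Real.exp (s * ‖x‖) ≤ Real.exp (s * ‖pos U ε 1 x p‖) :=
            Real.exp_le_exp.2 (mul_le_mul_of_nonneg_left h4 hs.le)
          nlinarith [hα0 p, hα1 p]
        · simp [h]
    have hSi : Integrable (S.indicator fun _ => Real.exp (s * ‖x‖)) (stdGaussian (E d)) :=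
      (integrable_const _).indicator hSm
    refine (integral_mono h2 (hi.add hSi) hle).trans ?_
    have hSr : (stdGaussian (E d)).real S ≤ (1 - l) / 2 :=
      ENNReal.toReal_le_of_le_ofReal (by linarith) hS
    have h7 := hdrift (meanPos U ε 1 x 0) x hxr (hm x hxR)
    simp only [Pi.add_apply]
    rw [integral_add hi hSi, integral_indicator_const _ hSm, smul_eq_mul]
    simp only [pos_one]
    have h8 := mul_le_mul_of_nonneg_right hSr (Real.exp_pos (s * ‖x‖)).le
    have h9 : 0 < Real.exp (s * M) * I + Real.exp (s * R₀) :=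
      add_pos_of_nonneg_of_pos (mul_nonneg (Real.exp_pos _).le hI0) (Real.exp_pos _)
    linarith
  · have hle : ∀ p, acceptProb U ε 1 x p * Real.exp (s * ‖pos U ε 1 x p‖)
          + (1 - acceptProb U ε 1 x p) * Real.exp (s * ‖x‖)
        ≤ Real.exp (s * ‖pos U ε 1 x p‖) + Real.exp (s * R₀) := by
      intro p
      have e1 := Real.exp_pos (s * ‖pos U ε 1 x p‖)
      have e2 := Real.exp_pos (s * ‖x‖)
      have h6 : Real.exp (s * ‖x‖) ≤ Real.exp (s * R₀) :=
        Real.exp_le_exp.2 (mul_le_mul_of_nonneg_left hx.le hs.le)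
      nlinarith [hα0 p, hα1 p]
    refine (integral_mono h2 (hi.add (integrable_const _)) hle).trans ?_
    simp only [Pi.add_apply]
    rw [integral_add hi (integrable_const _)]
    have h7 : Real.exp (s * ‖meanPos U ε 1 x 0‖) ≤ Real.exp (s * M) :=
      Real.exp_le_exp.2 (mul_le_mul_of_nonneg_left
        (hM x (by simpa using hx.le)) hs.le)
    have h8 := mul_le_mul_of_nonneg_right h7 hI0
    have h9 := Real.exp_pos (s * ‖x‖)
    simp only [integral_const, probReal_univ, one_smul]
    nlinarith

/-- The single-step mean drift alone, with inwards acceptance, gives geometric ergodicity. -/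
theorem geometricallyErgodic_of_meanPos_le {U : E d → ℝ} (hU : ContDiff ℝ 1 U)
    (hint : Integrable (fun x => Real.exp (-U x)) volume) {ε : ℝ} (hε : 0 < ε) (𝔏 : PMF ℕ)
    (h1 : 0 < 𝔏 1) (hin : InwardsAcceptance U ε 1) {η R : ℝ} (hη : 0 < η)
    (hm : ∀ x, R ≤ ‖x‖ → ‖meanPos U ε 1 x 0‖ ≤ ‖x‖ - η) :
    GeometricallyErgodic (hmcKernel hU ε 𝔏) (target U) := by
  have hπ : IsProbabilityMeasure (target U) := isProbabilityMeasure_tilted hint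
  obtain ⟨s, l, K, hs, hl0, hl1, hK, hdrift⟩ := exists_drift hU hε hin hη hm
  have h1top : 𝔏 1 ≠ ∞ := PMF.apply_ne_top _ _
  obtain ⟨ρ, hρ0, hρ1, hae⟩ := ae_exists_geometric_bound_of_drift
    (hmcKernel_isReversible hU ε 𝔏) (hmcKernel_isReversible hU ε (PMF.pure 1))
    (c := (𝔏 1).toReal) (ENNReal.toReal_pos h1.ne' h1top)
    (ENNReal.toReal_le_of_le_ofReal zero_le_one (by simpa using PMF.coe_le_one 𝔏 1))
    (fun x => by
      rw [ENNReal.ofReal_toReal h1top]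
      exact smul_hmcKernel_pure_le hU ε 𝔏 1 x)
    (V := fun x => Real.exp (s * ‖x‖)) (by fun_prop)
    (fun x => Real.one_le_exp (by positivity)) (fun x => (hdrift x).1) hl0 hl1 hK
    (fun x => (hdrift x).2) (fun R => by
      have hc : IsCompact {x : E d | Real.exp (s * ‖x‖) ≤ R} := by
        refine Metric.isCompact_of_isClosed_isBounded
          (isClosed_le (by fun_prop) continuous_const)
          ((Metric.isBounded_closedBall (x := (0 : E d)) (r := R / s)).subset fun x hx => ?_)
        have h2 := Real.add_one_le_exp (s * ‖x‖)
        have h3 : Real.exp (s * ‖x‖) ≤ R := hx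
        rw [mem_closedBall_zero_iff, le_div_iff₀ hs]
        linarith
      exact exists_minorization hU hint hε hc)
  have hρp : ∀ n : ℕ, ENNReal.ofReal ρ ^ n ≠ 0 := fun n =>
    pow_ne_zero _ (ENNReal.ofReal_pos.2 hρ0).ne'
  have hρt : ∀ n : ℕ, ENNReal.ofReal ρ ^ n ≠ ∞ := fun n => ENNReal.pow_ne_top ENNReal.ofReal_ne_top
  -- Taking the least admissible `M` makes the bound hold at every `x`, with value `∞` allowed; only
  -- almost-everywhere finiteness needs the preceding estimate.
  refine ⟨ρ, hρ0, hρ1, fun x => ⨆ n : ℕ,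
    tvDist ((hmcKernel hU ε 𝔏 ^ n) x) (target U) / ENNReal.ofReal ρ ^ n, ?_, fun n x => ?_⟩
  · filter_upwards [hae] with x ⟨c, hc⟩
    refine lt_of_le_of_lt (iSup_le fun n => ?_) (ENNReal.ofReal_lt_top (r := c))
    rw [ENNReal.div_le_iff (hρp n) (hρt n)]
    refine iSup_le fun f => iSup_le fun hf => iSup_le fun hf1 => ?_
    have hc0 : 0 ≤ c := by
      simpa using (abs_nonneg _).trans (hc 0 (fun _ => 0) measurable_const (by simp))
    rw [← ENNReal.ofReal_pow hρ0.le, ← ENNReal.ofReal_mul hc0]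
    exact ENNReal.ofReal_le_ofReal (hc n f hf hf1)
  · rw [← ENNReal.div_le_iff (hρp n) (hρt n)]
    exact le_iSup (fun n : ℕ => tvDist ((hmcKernel hU ε 𝔏 ^ n) x) (target U)
      / ENNReal.ofReal ρ ^ n) n

/-! ### Tail conditions imply a fixed inward shift of the one-step mean -/

theorem exists_eventually_lt_of_limsup_neg {α : Type*} {l : Filter α} {f : α → ℝ}
    (h : limsup (fun a => (f a : EReal)) l < 0) : ∃ η : ℝ, 0 < η ∧ ∀ᶠ a in l, f a < -η := by
  obtain ⟨r, hr, hr0⟩ := EReal.lt_iff_exists_real_btwn.1 h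
  refine ⟨-r, by simpa using hr0, ?_⟩
  filter_upwards [eventually_lt_of_limsup_lt hr] with a ha
  simpa using ha

theorem exists_eventually_gt_of_liminf_pos {α : Type*} {l : Filter α} {f : α → ℝ}
    (h : 0 < liminf (fun a => (f a : EReal)) l) : ∃ η : ℝ, 0 < η ∧ ∀ᶠ a in l, η < f a := by
  obtain ⟨r, hr, hr0⟩ := EReal.lt_iff_exists_real_btwn.1 h
  refine ⟨r, by simpa using hr, ?_⟩
  filter_upwards [eventually_lt_of_lt_liminf hr0] with a ha
  simpa using ha

/-- Zero momentum always satisfies the growth restriction, so phase-space conditions specialize to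
it. For `L = 1` nothing is lost, as the drift does not depend on the momentum. -/
theorem tendsto_farPhase (δ : ℝ) : Tendsto (fun x : E d => (x, (0 : E d))) (farPos d) (farPhase d δ) := by
  refine tendsto_inf.2 ⟨tendsto_comap_iff.2 tendsto_comap, tendsto_principal.2 ?_⟩
  refine Eventually.of_forall fun x => ?_
  simpa using Real.rpow_nonneg (norm_nonneg x) δ

theorem norm_le_sub_of_sq_le {η : ℝ} {m x : E d} (hx : η ≤ ‖x‖)
    (h : ‖m‖ ^ 2 ≤ ‖x‖ ^ 2 - 2 * η * ‖x‖) : ‖m‖ ≤ ‖x‖ - η := by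
  refine abs_le_of_sq_le_sq' ?_ (sub_nonneg.2 hx) |>.2
  nlinarith [sq_nonneg η]

theorem norm_meanPos_sq (U : E d → ℝ) (ε : ℝ) (L : ℕ) (x p : E d) :
    ‖meanPos U ε L x p‖ ^ 2
      = ‖x‖ ^ 2 + (‖drift U ε L x p‖ ^ 2 - 2 * inner ℝ (drift U ε L x p) x) := by
  rw [meanPos, norm_sub_sq_real, real_inner_comm]
  ring

theorem drift_one (U : E d → ℝ) (ε : ℝ) (x p : E d) :
    drift U ε 1 x p = (ε ^ 2 / 2) • gradient U x := by
  simp [drift]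

theorem exists_norm_meanPos_le_of_meanDrift {U : E d → ℝ} {ε δ : ℝ}
    (h : MeanDriftCondition U ε δ 1) :
    ∃ η : ℝ, 0 < η ∧ ∀ᶠ x in farPos d, ‖meanPos U ε 1 x 0‖ ≤ ‖x‖ - η := by
  obtain ⟨η, hη, h⟩ := exists_eventually_lt_of_limsup_neg h
  refine ⟨η, hη, ?_⟩
  filter_upwards [(tendsto_farPhase δ).eventually h] with x hx
  linarith

theorem eventually_le_norm (r : ℝ) : ∀ᶠ x in farPos d, r ≤ ‖x‖ :=
  eventually_farPos.2 ⟨r, fun _ h => h⟩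

theorem exists_norm_meanPos_le_of_smallStep {U : E d → ℝ} {ε δ : ℝ}
    (h : SmallStepCondition U ε δ 1) :
    ∃ η : ℝ, 0 < η ∧ ∀ᶠ x in farPos d, ‖meanPos U ε 1 x 0‖ ≤ ‖x‖ - η := by
  obtain ⟨η, hη, h⟩ := exists_eventually_lt_of_limsup_neg h.2
  refine ⟨η, hη, ?_⟩
  filter_upwards [(tendsto_farPhase δ).eventually h, eventually_le_norm η] with x hx hxη
  refine norm_le_sub_of_sq_le hxη ?_
  rw [norm_meanPos_sq]
  rw [div_lt_iff₀ (by linarith)] at hx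
  linarith

/-- In `‖m‖² - ‖x‖²` the inner product contributes at most `-ε² c ‖∇U‖ ‖x‖`. The threshold `2 c /
ε²` on `‖∇U‖ / ‖x‖` lets the quadratic term consume at most half of this; the lower bound `a` on
`‖∇U‖` makes the other half at least `2 η ‖x‖`. -/
theorem exists_norm_meanPos_le_of_sublinear {U : E d → ℝ} {ε : ℝ} (hε : 0 < ε)
    (h1 : GradNonvanishing U) (h2 : GradInwards U) (h3 : GradSublinear U) :
    ∃ η : ℝ, 0 < η ∧ ∀ᶠ x in farPos d, ‖meanPos U ε 1 x 0‖ ≤ ‖x‖ - η := by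
  obtain ⟨a, ha, h1⟩ := exists_eventually_gt_of_liminf_pos h1
  obtain ⟨c, hc, h2⟩ := exists_eventually_gt_of_liminf_pos h2
  refine ⟨ε ^ 2 * c * a / 4, by positivity, ?_⟩
  filter_upwards [h1, h2, h3.eventually_lt_const (u := 2 * c / ε ^ 2) (by positivity),
    eventually_le_norm (ε ^ 2 * c * a / 4)] with x hg hi hs hx
  have hx0 : 0 < ‖x‖ := lt_of_lt_of_le (by positivity) hx
  have hg0 : 0 < ‖gradient U x‖ := ha.trans hg
  refine norm_le_sub_of_sq_le hx ?_
  rw [norm_meanPos_sq, drift_one, norm_smul, real_inner_smul_left,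
    Real.norm_of_nonneg (by positivity)]
  rw [lt_div_iff₀ (by positivity)] at hi
  rw [div_lt_iff₀ hx0] at hs
  have h4 : ε ^ 2 * ‖gradient U x‖ ≤ 2 * c * ‖x‖ := by
    have := mul_le_mul_of_nonneg_left hs.le (sq_nonneg ε)
    have e : ε ^ 2 * (2 * c / ε ^ 2 * ‖x‖) = 2 * c * ‖x‖ := by field_simp
    linarith
  have h5 : ε ^ 2 / 4 * ‖gradient U x‖ * (ε ^ 2 * ‖gradient U x‖)
      ≤ ε ^ 2 / 4 * ‖gradient U x‖ * (2 * c * ‖x‖) :=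
    mul_le_mul_of_nonneg_left h4 (by positivity)
  have h6 : ε ^ 2 * (c * (‖gradient U x‖ * ‖x‖)) ≤ ε ^ 2 * inner ℝ (gradient U x) x :=
    mul_le_mul_of_nonneg_left hi.le (sq_nonneg ε)
  have h7 : ε ^ 2 * c * ‖x‖ * a ≤ ε ^ 2 * c * ‖x‖ * ‖gradient U x‖ :=
    mul_le_mul_of_nonneg_left hg.le (by positivity)
  nlinarith

end HMC

end

theorem mainTheorem1 (d : ℕ) (U : HMC.E d → ℝ) (hU : ContDiff ℝ 1 U)
    (hint : Integrable (fun x => Real.exp (-U x)) volume)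
    (ε : ℝ) (hε : 0 < ε) (𝔏 : PMF ℕ) (δ : ℝ) (hδ₀ : 1 / 2 < δ) (hδ₁ : δ < 1)
    (hstep : HMC.StepNumberCondition U ε 𝔏)
    (hinwards : ∀ L ∈ 𝔏.support, HMC.InwardsAcceptance U ε L) :
    ((∀ L ∈ 𝔏.support, HMC.MeanDriftCondition U ε δ L) →
      HMC.GeometricallyErgodic (HMC.hmcKernel hU ε 𝔏) (HMC.target U)) ∧
    (HMC.TailCondition U ε δ 𝔏 →
      HMC.GeometricallyErgodic (HMC.hmcKernel hU ε 𝔏) (HMC.target U)) := by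
  have h1 : 1 ∈ 𝔏.support := (𝔏.mem_support_iff 1).2 hstep.1.ne'
  have key : (∃ η : ℝ, 0 < η ∧ ∀ᶠ x in HMC.farPos d, ‖HMC.meanPos U ε 1 x 0‖ ≤ ‖x‖ - η) →
      HMC.GeometricallyErgodic (HMC.hmcKernel hU ε 𝔏) (HMC.target U) := by
    rintro ⟨η, hη, h⟩
    obtain ⟨R, hR⟩ := HMC.eventually_farPos.1 h
    exact HMC.geometricallyErgodic_of_meanPos_le hU hint hε 𝔏 hstep.1 (hinwards 1 h1) hη hR
  refine ⟨fun h => key (HMC.exists_norm_meanPos_le_of_meanDrift (h 1 h1)), ?_⟩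
  rintro ⟨hn, hi, hs | ⟨-, hs⟩⟩
  · exact key (HMC.exists_norm_meanPos_le_of_sublinear hε hn hi hs)
  · exact key (HMC.exists_norm_meanPos_le_of_smallStep (hs 1 h1))
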